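/- Let $p$ be a prime, let $0\le k\le n$ and $\nu\ge 0$ be integers, and let $d_1,\dots,d_\nu\ge 0$ be integers with $$\sum_{j=1}^{\nu}\binom{k+d_j}{d_j}=(k+1)(n-k).$$ Let $\lambda$ denote the Haar measure on $\mathbb{Q}_p$ with $\lambda(\mathbb{Z}_p)=1$, and also the product measure on the spaces of square matrices $\mathbb{Q}_p^{m\times m}$. For $j=1,\dots,\nu$ let $$f_j=\sum_{|\alpha|=d_j}\xi^{(j)}_\alpha\, x_0^{\alpha_0}\cdots x_n^{\alpha_n},$$ where all the coefficients $\xi^{(j)}_\alpha$ ($1\le j\le\nu$, $|\alpha|=d_j$) are independent random variables uniformly distributed in $\mathbb{Z}_p$ (i.e. with law $\lambda|_{\mathbb{Z}_p}$). Let $Z(f_1,\dots,f_\nu)\subset\mathbb{Q}_p\mathrm{P}^n$ be the common zero set. Let $\mathbb{Q}_p\mathbb{G}_{k,n}$ be the Grassmannian of $k$-flats $\ell=P(L)$ in $\mathbb{Q}_p\mathrm{P}^n$, where $L\subset\mathbb{Q}_p^{n+1}$ is a linear subspace of dimension $k+1$, with its usual topology. Let $\mu$ be the measure on it defined by $$\mu=\frac{1}{\lambda(\mathrm{GL}_{n-k}(\mathbb{Z}_p))\,\lambda(\mathrm{GL}_{k+1}(\mathbb{Z}_p))}\;q_*\big(\lambda|_{\mathrm{GL}_{n+1}(\mathbb{Z}_p)}\big),$$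 where $q(M)$ is the flat spanned by the first $k+1$ columns of $M$. Let $\tau$ be the tautological bundle, with fibre $L$ over $P(L)$, so that the fibre of $\mathrm{Sym}^{d}(\tau^*)$ over $P(L)$ is the space of homogeneous polynomial functions of degree $d$ on $L$. Let $\sigma_f=\sigma_{f_1}\oplus\cdots\oplus\sigma_{f_\nu}$ be the section of $\bigoplus_j\mathrm{Sym}^{d_j}(\tau^*)$ given by $\sigma_{f_j}(P(L))=f_j|_L$. Let $$\psi_f:\mathbb{Q}_p^{(n-k)\times(k+1)}\to\bigoplus_{j=1}^{\nu}\mathbb{Q}_p^{\binom{k+d_j}{d_j}}\cong\mathbb{Q}_p^{(n-k)(k+1)}$$ be the section $\sigma_f$ in the standard affine chart: it sends a matrix $A$ to the list of the coefficients of the polynomials $$f_j\left(\begin{pmatrix}\mathbf{1}_{k+1}\\ A\end{pmatrix}y\right)\in\mathbb{Q}_p[y_0,\dots,y_k]_{(d_j)},\qquad j=1,\dots,\nu .$$ Let $J\psi_f(0)$ be its Jacobian matrix at $A=0$, a square matrix after any ordering of its rows and columns, the choice of which does not affect $|\det J\psi_f(0)|_p$. Then the number of $k$-flats contained in $Z(f_1,\dots,f_\nu)$,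 the number of zeroes of $\sigma_f$ and $|\det J\psi_f(0)|_p$ are random variables (with values in $[0,\infty]$), and $$\mathbb{E}\,\#\{k\text{-flats on }Z(f_1,\dots,f_\nu)\}=\mathbb{E}\,\#\{\sigma_f=0\}=\mu(\mathbb{Q}_p\mathbb{G}_{k,n})\cdot\mathbb{E}\,|\det J\psi_f(0)|_p ,$$ where $$\mu(\mathbb{Q}_p\mathbb{G}_{k,n})=\frac{\lambda(\mathrm{GL}_{n+1}(\mathbb{Z}_p))}{\lambda(\mathrm{GL}_{k+1}(\mathbb{Z}_p))\,\lambda(\mathrm{GL}_{n-k}(\mathbb{Z}_p))}.$$ -/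

import Mathlib

open MeasureTheory ProbabilityTheory
open scoped ENNReal LinearAlgebra.Projectivization

namespace PadicFlats

noncomputable section

/-! ### Haar measure on `ℚ_p` and related spaces -/

instance instMeasurableSpacePadic (p : ℕ) [Fact p.Prime] : MeasurableSpace ℚ_[p] := borel _

instance instBorelSpacePadic (p : ℕ) [Fact p.Prime] : BorelSpace ℚ_[p] := ⟨rfl⟩

instance instMeasurableSpacePadicInt (p : ℕ) [Fact p.Prime] : MeasurableSpace ℤ_[p] := borel _

instance instBorelSpacePadicInt (p : ℕ) [Fact p.Prime] : BorelSpace ℤ_[p] := ⟨rfl⟩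

/-- The unit ball `ℤ_p = {x ∈ ℚ_p : |x|_p ≤ 1}`, a compact set with nonempty interior. -/
def unitBall (p : ℕ) [Fact p.Prime] : TopologicalSpace.PositiveCompacts ℚ_[p] where
  carrier := Metric.closedBall 0 1
  isCompact' := isCompact_closedBall 0 1
  interior_nonempty' :=
    ⟨0, Metric.ball_subset_interior_closedBall (Metric.mem_ball_self one_pos)⟩

/-- The Haar measure on `ℚ_p`, normalized so that `ℤ_p` has measure one. -/
def haarPadic (p : ℕ) [Fact p.Prime] : Measure ℚ_[p] := Measure.addHaarMeasure (unitBall p)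

/-- The uniform distribution on `ℤ_p`: the restriction of the Haar measure of `ℚ_p`. -/
def uniformPadicInt (p : ℕ) [Fact p.Prime] : Measure ℤ_[p] :=
  (haarPadic p).comap (fun x : ℤ_[p] => (x : ℚ_[p]))

/-- The Haar measure `λ` on the `n × n` matrices over `ℚ_p` (the product measure), for which the
matrices with entries in `ℤ_p` have measure one. -/
def haarMatrix (p : ℕ) [Fact p.Prime] (n : ℕ) : Measure (Fin n → Fin n → ℚ_[p]) :=
  Measure.pi fun _ => Measure.pi fun _ => haarPadic p

/-- `GL_n(ℤ_p)` as a set of `n × n` matrices over `ℚ_p`. -/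
def glSet (p : ℕ) [Fact p.Prime] (n : ℕ) : Set (Fin n → Fin n → ℚ_[p]) :=
  Set.range fun (g : GL (Fin n) ℤ_[p]) (i j : Fin n) => ((g.val i j : ℤ_[p]) : ℚ_[p])

/-- `λ(GL_n(ℤ_p))`. -/
def volGL (p : ℕ) [Fact p.Prime] (n : ℕ) : ℝ≥0∞ := haarMatrix p n (glSet p n)

/-! ### The Grassmannian of `k`-flats in projective `n`-space -/

/-- The Grassmannian of `k`-flats `ℓ = P(L)` in `n`-dimensional projective space over `ℚ_p`, given
through the `(k+1)`-dimensional linear subspaces `L` of `ℚ_p^{n+1}`. -/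
def Grass (p : ℕ) [Fact p.Prime] (k n : ℕ) : Type :=
  {L : Submodule ℚ_[p] (Fin (n + 1) → ℚ_[p]) // Module.finrank ℚ_[p] L = k + 1}

/-- The flat spanned by the columns of an `(n+1) × (k+1)` matrix of rank `k+1`. -/
def colSpan (p : ℕ) [Fact p.Prime] (k n : ℕ)
    (B : {B : Matrix (Fin (n + 1)) (Fin (k + 1)) ℚ_[p] // Function.Injective B.mulVecLin}) :
    Grass p k n :=
  ⟨LinearMap.range B.1.mulVecLin, by
    rw [LinearMap.finrank_range_of_inj B.2]; simp⟩

/-- The quotient topology of the matrices of rank `k+1`. -/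
instance instTopologicalSpaceGrass (p : ℕ) [Fact p.Prime] (k n : ℕ) :
    TopologicalSpace (Grass p k n) :=
  TopologicalSpace.coinduced (colSpan p k n) inferInstance

instance instMeasurableSpaceGrass (p : ℕ) [Fact p.Prime] (k n : ℕ) :
    MeasurableSpace (Grass p k n) := borel _

instance instBorelSpaceGrass (p : ℕ) [Fact p.Prime] (k n : ℕ) : BorelSpace (Grass p k n) := ⟨rfl⟩

/-- The `(n+1) × (k+1)` matrix whose upper `(k+1) × (k+1)` block is the identity and whose lower
block is `A`. -/
def graphMatrix (R : Type) [CommRing R] (k n : ℕ) (A : Fin (n - k) × Fin (k + 1) → R) :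
    Matrix (Fin (n + 1)) (Fin (k + 1)) R :=
  fun i j =>
    if h : i.val < k + 1 then (if i.val = j.val then 1 else 0)
    else A (⟨i.val - (k + 1), by have := i.isLt; omega⟩, j)

theorem graphMatrix_injective {R : Type} [CommRing R] {k n : ℕ} (hkn : k ≤ n)
    (A : Fin (n - k) × Fin (k + 1) → R) :
    Function.Injective (graphMatrix R k n A).mulVecLin := by
  intro x y hxy
  funext j
  have h := congrFun hxy (Fin.castLE (by omega) j)
  have key : ∀ z : Fin (k + 1) → R,
      (graphMatrix R k n A).mulVecLin z (Fin.castLE (by omega) j) = z j := by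
    intro z
    simp only [Matrix.mulVecLin_apply, Matrix.mulVec, dotProduct, graphMatrix, Fin.val_castLE,
      j.isLt, dite_true, Fin.val_inj, ite_mul, one_mul, zero_mul, Finset.sum_ite_eq,
      Finset.mem_univ, if_true]
  rwa [key, key] at h

/-- The inverse `A ↦ im (1, A)` of the standard affine chart `φ` of the Grassmannian. -/
def chartInv (p : ℕ) [Fact p.Prime] (k n : ℕ) (hkn : k ≤ n)
    (A : Fin (n - k) × Fin (k + 1) → ℚ_[p]) : Grass p k n :=
  colSpan p k n ⟨graphMatrix ℚ_[p] k n A, graphMatrix_injective hkn A⟩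

theorem mulVecLin_injective_of_mem_glSet {p : ℕ} [Fact p.Prime] {n : ℕ}
    {M : Fin n → Fin n → ℚ_[p]} (hM : M ∈ glSet p n) :
    Function.Injective (Matrix.of M).mulVecLin := by
  obtain ⟨g, rfl⟩ := hM
  have hu : IsUnit ((g : Matrix (Fin n) (Fin n) ℤ_[p]).map (PadicInt.Coe.ringHom (p := p))) :=
    (Units.isUnit g).map (PadicInt.Coe.ringHom (p := p)).mapMatrix
  exact Matrix.mulVec_injective_of_isUnit hu

/-- The map `q : GL_{n+1}(ℤ_p) → Grass`, sending `M` to the span of its first `k+1` columns, that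
is, to the image of `M (1, 0)`. -/
def grassMap (p : ℕ) [Fact p.Prime] (k n : ℕ) (hkn : k ≤ n) (M : glSet p (n + 1)) : Grass p k n :=
  colSpan p k n ⟨Matrix.of M.1 * graphMatrix ℚ_[p] k n 0, by
    rw [Matrix.mulVecLin_mul]
    exact (mulVecLin_injective_of_mem_glSet M.2).comp (graphMatrix_injective hkn 0)⟩

/-- The measure `μ` on the Grassmannian: the pushforward under `q` of the Haar measure of
`GL_{n+1}(ℤ_p)`, divided by `λ(GL_{n-k}(ℤ_p)) λ(GL_{k+1}(ℤ_p))`. -/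
def grassMeasure (p : ℕ) [Fact p.Prime] (k n : ℕ) (hkn : k ≤ n) : Measure (Grass p k n) :=
  (volGL p (n - k) * volGL p (k + 1))⁻¹ •
    Measure.map (grassMap p k n hkn) ((haarMatrix p (n + 1)).comap Subtype.val)

/-! ### Homogeneous polynomials and sections -/

/-- The exponents of the monomials of degree `d` in `n + 1` variables. -/
abbrev Exps (n d : ℕ) : Type :=
  {α // α ∈ Finset.finsuppAntidiag (Finset.univ : Finset (Fin (n + 1))) d}

/-- `Sym^d(V*)`, as the space of homogeneous polynomial functions of degree `d` on `V`, that is, of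
the functions that are given by a homogeneous polynomial of degree `d` in linear functionals. -/
def symDual (K V : Type) [Field K] [AddCommGroup V] [Module K V] (d : ℕ) : Submodule K (V → K) :=
  Submodule.map
    (LinearMap.pi fun v : V =>
      (MvPolynomial.aeval (R := K) fun l : Module.Dual K V => l v).toLinearMap)
    (MvPolynomial.homogeneousSubmodule (Module.Dual K V) K d)

/-- The fibre over `ℓ = P(L)` of the bundle `⨁ⱼ Sym^{dⱼ}(τ*)`, where `τ` is the tautological
bundle, whose fibre over `ℓ` is `L`. -/
abbrev Fibre (p : ℕ) [Fact p.Prime] (k n : ℕ) {ν : ℕ} (d : Fin ν → ℕ) (ℓ : Grass p k n) : Type :=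
  ∀ j : Fin ν, symDual ℚ_[p] ℓ.1 (d j)

/-- Lists of homogeneous polynomials with coefficients in `ℤ_p` of degrees `d₁, …, d_ν` in the
variables `x₀, …, x_n`. -/
abbrev PolyList (p : ℕ) [Fact p.Prime] (n : ℕ) {ν : ℕ} (d : Fin ν → ℕ) : Type :=
  ∀ j : Fin ν, MvPolynomial.homogeneousSubmodule (Fin (n + 1)) ℤ_[p] (d j)

/-- The polynomial function on `ℚ_p^{n+1}` given by a polynomial with coefficients in `ℤ_p`. -/
def polyFun (p : ℕ) [Fact p.Prime] (n : ℕ) (f : MvPolynomial (Fin (n + 1)) ℤ_[p])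
    (v : Fin (n + 1) → ℚ_[p]) : ℚ_[p] :=
  MvPolynomial.aeval v f

theorem polyFun_restrict_mem (p : ℕ) [Fact p.Prime] (n d : ℕ)
    (f : MvPolynomial.homogeneousSubmodule (Fin (n + 1)) ℤ_[p] d)
    (L : Submodule ℚ_[p] (Fin (n + 1) → ℚ_[p])) :
    (fun v : L => polyFun p n f.1 v.1) ∈ symDual ℚ_[p] L d := by
  refine ⟨MvPolynomial.rename (fun i => (LinearMap.proj i).comp L.subtype)
    (MvPolynomial.map (algebraMap ℤ_[p] ℚ_[p]) f.1), ?_, ?_⟩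
  · exact MvPolynomial.IsHomogeneous.rename_isHomogeneous (f.2.map _)
  · funext v
    simp [polyFun, MvPolynomial.aeval_rename, Function.comp_def, MvPolynomial.aeval_map_algebraMap]

/-- The section `σ_f = σ_{f₁} ⊕ ⋯ ⊕ σ_{f_ν}`, where `σ_{fⱼ}(P(L)) = fⱼ|_L`. -/
def sectionOf (p : ℕ) [Fact p.Prime] (k n : ℕ) {ν : ℕ} (d : Fin ν → ℕ) (f : PolyList p n d)
    (ℓ : Grass p k n) : Fibre p k n d ℓ :=
  fun j => ⟨fun v : ℓ.1 => polyFun p n (f j).1 v.1, polyFun_restrict_mem p n (d j) (f j) ℓ.1⟩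

/-- The zeroes of the section `σ_f`. -/
def sectionZeros (p : ℕ) [Fact p.Prime] (k n : ℕ) {ν : ℕ} (d : Fin ν → ℕ) (f : PolyList p n d) :
    Set (Grass p k n) :=
  {ℓ | sectionOf p k n d f ℓ = 0}

/-- The common zero set `Z(f₁, …, f_ν)` in projective `n`-space over `ℚ_p`. -/
def zeroLocus (p : ℕ) [Fact p.Prime] (n : ℕ) {ν : ℕ} (d : Fin ν → ℕ) (f : PolyList p n d) :
    Set (ℙ ℚ_[p] (Fin (n + 1) → ℚ_[p])) :=
  {x | ∀ j, polyFun p n (f j).1 x.rep = 0}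

/-- The `k`-flats on `Z(f₁, …, f_ν)`. -/
def flatsOn (p : ℕ) [Fact p.Prime] (k n : ℕ) {ν : ℕ} (d : Fin ν → ℕ) (f : PolyList p n d) :
    Set (Grass p k n) :=
  {ℓ | {x : ℙ ℚ_[p] (Fin (n + 1) → ℚ_[p]) | x.submodule ≤ ℓ.1} ⊆ zeroLocus p n d f}

/-! ### The section in the standard affine chart -/

/-- The polynomial `f((1, A) y)` in the variables `y = (y₀, …, y_k)`. -/
def chartPoly (p : ℕ) [Fact p.Prime] (k n : ℕ) (f : MvPolynomial (Fin (n + 1)) ℤ_[p])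
    (A : Fin (n - k) × Fin (k + 1) → ℚ_[p]) : MvPolynomial (Fin (k + 1)) ℚ_[p] :=
  MvPolynomial.aeval
    (fun i => ∑ l, MvPolynomial.C (graphMatrix ℚ_[p] k n A i l) * MvPolynomial.X l) f

/-- The index set of the coefficients of lists of homogeneous polynomials of degrees `d₁, …, d_ν`
in the variables `y₀, …, y_k`. -/
abbrev CoeffIndex (k : ℕ) {ν : ℕ} (d : Fin ν → ℕ) : Type := Σ j : Fin ν, Exps k (d j)

/-- The map `ψ_f`, the section `σ_f` in the chart `φ` and the monomial trivialization: it sends `A`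
to the list of the coefficients of the polynomials `fⱼ((1, A) y)`. -/
def psi (p : ℕ) [Fact p.Prime] (k n : ℕ) {ν : ℕ} (d : Fin ν → ℕ) (f : PolyList p n d)
    (A : Fin (n - k) × Fin (k + 1) → ℚ_[p]) : CoeffIndex k d → ℚ_[p] :=
  fun r => MvPolynomial.coeff r.2.1 (chartPoly p k n (f r.1).1 A)

/-- `fⱼ((1, A) y)` is the value of `σ_{fⱼ}` over the point `φ⁻¹(A)`, expressed in the coordinates
`y` of that flat. -/
theorem eval_chartPoly (p : ℕ) [Fact p.Prime] (k n : ℕ) (hkn : k ≤ n) {ν : ℕ} (d : Fin ν → ℕ)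
    (f : PolyList p n d) (A : Fin (n - k) × Fin (k + 1) → ℚ_[p]) (j : Fin ν)
    (y : Fin (k + 1) → ℚ_[p]) :
    MvPolynomial.eval y (chartPoly p k n (f j).1 A) =
      (sectionOf p k n d f (chartInv p k n hkn A) j).1
        ⟨(graphMatrix ℚ_[p] k n A).mulVec y, ⟨y, rfl⟩⟩ := by
  have h : (MvPolynomial.aeval (R := ℚ_[p]) y) (chartPoly p k n (f j).1 A) =
      MvPolynomial.aeval ((graphMatrix ℚ_[p] k n A).mulVec y) (f j).1 := by
    rw [chartPoly]
    rw [← AlgHom.restrictScalars_apply ℤ_[p] (MvPolynomial.aeval (R := ℚ_[p]) y),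
      ← AlgHom.comp_apply, MvPolynomial.comp_aeval]
    congr 2
    funext i
    simp [Matrix.mulVec, dotProduct]
  exact h

/-- The Jacobian matrix `Jψ_f(A)` of partial derivatives. -/
def jacobian (p : ℕ) [Fact p.Prime] (k n : ℕ) {ν : ℕ} (d : Fin ν → ℕ) (f : PolyList p n d)
    (A : Fin (n - k) × Fin (k + 1) → ℚ_[p]) :
    Matrix (CoeffIndex k d) (Fin (n - k) × Fin (k + 1)) ℚ_[p] :=
  LinearMap.toMatrix' (fderiv ℚ_[p] (psi p k n d f) A).toLinearMap

/-- When the rank of the bundle is the dimension of the Grassmannian, the rows and the columns of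
the Jacobian matrix can be put in bijection. -/
theorem nonempty_equiv (k n : ℕ) {ν : ℕ} (d : Fin ν → ℕ)
    (hd : ∑ j, Nat.choose (k + d j) (d j) = (k + 1) * (n - k)) :
    Nonempty (Fin (n - k) × Fin (k + 1) ≃ CoeffIndex k d) := by
  refine ⟨Fintype.equivOfCardEq ?_⟩
  rw [Fintype.card_sigma]
  simp only [Fintype.card_prod, Fintype.card_fin, Fintype.card_coe]
  rw [mul_comm, ← hd]
  refine Finset.sum_congr rfl fun j _ => ?_
  rw [Finset.card_finsuppAntidiag_nat_eq_choose, Finset.card_univ, Fintype.card_fin]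
  congr 1
  omega

/-! ### Random polynomials -/

/-- The list of polynomials `fⱼ = ∑_{|α| = dⱼ} ξⱼ,α x^α` with given coefficients. -/
def polyOfCoeffs (p : ℕ) [Fact p.Prime] (n : ℕ) {ν : ℕ} (d : Fin ν → ℕ)
    (ξ : (Σ j : Fin ν, Exps n (d j)) → ℤ_[p]) : PolyList p n d :=
  fun j => ⟨∑ α : Exps n (d j), MvPolynomial.monomial α.1 (ξ ⟨j, α⟩),
    Submodule.sum_mem _ fun α _ => MvPolynomial.isHomogeneous_monomial _ (by
      have := (Finset.mem_finsuppAntidiag.mp α.2).1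
      rw [Finsupp.degree_eq_sum]; exact this)⟩

end

end PadicFlats

/-! The proof counts zeroes at resolution `p ^ r` and lets `r` grow. Let `Γ_r` be the group of
matrices in `GL_{n+1}(ℤ_p)` whose lower left block is divisible by `p ^ r`. Every flat is spanned by
the first `k + 1` columns of some matrix in `GL_{n+1}(ℤ_p)` (`flat_surjective`), and so has a class
in the finite set `GL_{n+1}(ℤ_p) / Γ_r`. The number `N_r` of classes that contain a zero of the
section is at most the number `N` of zeroes and tends to it, since distinct flats are eventually
separated (`tendsto_encard_image`).

Substituting a matrix of `GL_{n+1}(ℤ_p)` preserves the law of the coefficients, so all classes are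
equally likely to contain a zero. Hence `E N_r` is the index of `Γ_r` times the probability of a
zero in the ball `p ^ r ℤ_p^κ` around the origin of the standard chart, where `κ` indexes the chart
coordinates (`lintegral_encard_flatClass_image`). The block shape of `Γ_r` shows that the index is
`p ^ (r |κ|)` times the quotient of volumes in the statement (`index_congrSubgroup_eq`).

For the probability, note that altering `f` by polynomials in `x₀, …, x_k` alone translates `ψ_f` by
a constant vector, which can be arbitrary in `ℤ_p^κ`. Averaging over these translations shows that
the probability equals the expected volume of the image of the ball under `ψ_f`
(`uniformPi_zeroNear`). Multiplied by `p ^ (r |κ|)`, this volume is at most one and converges to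
`|det Jψ_f(0)|` for each `f`, with no nondegeneracy condition (`tendsto_measure_polyMap_divSet`), so
dominated convergence applies.

Finally, `E N_r → E N`: Fatou's lemma gives one inequality and `N_r ≤ N` the other. -/

namespace PadicFlats

/-! ### Scaling of Haar measures under isomorphisms of groups -/

section HaarScaling

variable {E F : Type*} [AddCommGroup E] [TopologicalSpace E] [IsTopologicalAddGroup E]
  [LocallyCompactSpace E] [SecondCountableTopology E] [MeasurableSpace E] [BorelSpace E]
  [AddCommGroup F] [TopologicalSpace F] [IsTopologicalAddGroup F] [MeasurableSpace F] [BorelSpace F]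

/-- An isomorphism of locally compact groups multiplies Haar measures by a constant. -/
theorem exists_measure_image_eq_mul (μ : Measure E) [μ.IsAddHaarMeasure] (ν : Measure F)
    [ν.IsAddHaarMeasure] (φ : E ≃ₜ+ F) :
    ∃ c : ℝ≥0∞, ∀ s : Set E, ν (φ '' s) = c * μ s := by
  have hh : (ν.map φ.symm).IsAddHaarMeasure := inferInstance
  obtain h := Measure.isAddLeftInvariant_eq_smul (ν.map φ.symm) μ
  refine ⟨Measure.addHaarScalarFactor (ν.map φ.symm) μ, fun s => ?_⟩
  have h1 : (ν.map φ.symm) s = ν (φ '' s) := by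
    have := φ.symm.toHomeomorph.toMeasurableEquiv.map_apply (μ := ν) s
    refine Eq.trans this ?_
    congr 1
    ext y
    constructor
    · intro hy
      exact ⟨φ.symm y, hy, by simp⟩
    · rintro ⟨x, hx, rfl⟩
      have h2 : φ.symm (φ x) = x := φ.symm_apply_apply x
      exact (congrArg (· ∈ s) h2).mpr hx
  rw [← h1]
  conv_lhs => rw [h]
  rfl

/-- The scaling constant is determined by any single set of positive finite measure. Below, the test
set is always a box or a lattice whose image is evident. -/
theorem measure_image_eq_of_eq (μ : Measure E) [μ.IsAddHaarMeasure] (ν : Measure F)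
    [ν.IsAddHaarMeasure] (φ : E ≃ₜ+ F) {s₀ : Set E} (h0 : μ s₀ ≠ 0) (htop : μ s₀ ≠ ∞)
    (h : ν (φ '' s₀) = μ s₀) (s : Set E) : ν (φ '' s) = μ s := by
  obtain ⟨c, hc⟩ := exists_measure_image_eq_mul μ ν φ
  have h1 : c * μ s₀ = 1 * μ s₀ := by rw [← hc, h, one_mul]
  rw [hc, (ENNReal.mul_left_inj h0 htop).mp h1, one_mul]

end HaarScaling

/-! ### Haar measure on `ℚ_p`: balls and points -/

variable {p : ℕ} [hp : Fact p.Prime]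

instance : (haarPadic p).IsAddHaarMeasure := by unfold haarPadic; infer_instance

theorem haarPadic_closedBall_one : haarPadic p (Metric.closedBall 0 1) = 1 :=
  Measure.addHaarMeasure_self (K₀ := unitBall p)

theorem range_coe_padicInt :
    Set.range (fun x : ℤ_[p] => (x : ℚ_[p])) = Metric.closedBall 0 1 := by
  ext x
  simp only [Set.mem_range, mem_closedBall_zero_iff]
  exact ⟨fun ⟨y, hy⟩ => hy ▸ y.2, fun h => ⟨⟨x, h⟩, rfl⟩⟩

theorem isOpenEmbedding_coe_padicInt :
    Topology.IsOpenEmbedding (fun x : ℤ_[p] => (x : ℚ_[p])) :=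
  PadicInt.isOpenEmbedding_coe

theorem uniformPadicInt_apply (s : Set ℤ_[p]) :
    uniformPadicInt p s = haarPadic p ((fun x : ℤ_[p] => (x : ℚ_[p])) '' s) :=
  (isOpenEmbedding_coe_padicInt (p := p)).measurableEmbedding.comap_apply _ _

instance : (uniformPadicInt p).IsAddHaarMeasure :=
  Measure.IsAddHaarMeasure.comap (mH := inferInstance) (haarPadic p)
    (f := (PadicInt.Coe.ringHom (p := p)).toAddMonoidHom) isOpenEmbedding_coe_padicInt

instance : IsProbabilityMeasure (uniformPadicInt p) :=
  ⟨by rw [uniformPadicInt_apply, Set.image_univ, range_coe_padicInt, haarPadic_closedBall_one]⟩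

/-- The multiplication by a nonzero element of `ℚ_p`, as an automorphism of the additive group. -/
noncomputable def mulLeftEquiv (a : ℚ_[p]) (ha : a ≠ 0) : ℚ_[p] ≃ₜ+ ℚ_[p] :=
  { (LinearEquiv.smulOfNeZero ℚ_[p] ℚ_[p] a ha).toAddEquiv with
    continuous_toFun := continuous_const_mul a
    continuous_invFun := continuous_const_mul a⁻¹ }

theorem mulLeftEquiv_apply (a : ℚ_[p]) (ha : a ≠ 0) :
    ⇑(mulLeftEquiv a ha) = fun x => a * x := rfl

theorem image_mul_closedBall (a : ℚ_[p]) (ha : a ≠ 0) (r : ℝ) :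
    (fun x => a * x) '' Metric.closedBall 0 r = Metric.closedBall 0 (‖a‖ * r) := by
  ext x
  simp only [Set.mem_image, mem_closedBall_zero_iff]
  have h0 : 0 < ‖a‖ := norm_pos_iff.mpr ha
  constructor
  · rintro ⟨y, hy, rfl⟩
    rw [norm_mul]
    gcongr
  · intro h
    refine ⟨a⁻¹ * x, ?_, by field_simp⟩
    rw [norm_mul, norm_inv, inv_mul_le_iff₀ h0]
    exact h

/-- The unit ball serves as test set: its image is the ball of radius `‖a‖`, so the measure of that
ball is the scaling constant. -/
theorem haarPadic_image_mul (a : ℚ_[p]) (ha : a ≠ 0) (s : Set ℚ_[p]) :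
    haarPadic p ((fun x => a * x) '' s) =
      haarPadic p (Metric.closedBall 0 ‖a‖) * haarPadic p s := by
  obtain ⟨c, hc⟩ := exists_measure_image_eq_mul (haarPadic p) (haarPadic p) (mulLeftEquiv a ha)
  rw [mulLeftEquiv_apply] at hc
  have h1 : haarPadic p (Metric.closedBall 0 ‖a‖) = c := by
    have := hc (Metric.closedBall 0 1)
    rw [haarPadic_closedBall_one, mul_one] at this
    rw [← this]
    exact congrArg _ (by simpa using (image_mul_closedBall a ha 1).symm)
  rw [h1]
  exact hc s

/-- The ball is the kernel of the reduction `ℤ_p → ℤ/p`, a subgroup of index `p` in a group of total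
mass one. -/
theorem haarPadic_closedBall_p :
    haarPadic p (Metric.closedBall 0 ‖(p : ℚ_[p])‖) = (p : ℝ≥0∞)⁻¹ := by
  have hker : (PadicInt.toZMod (p := p)).toAddMonoidHom.ker.index = p := by
    rw [AddSubgroup.index_ker, AddMonoidHom.range_eq_top.mpr]
    · simp
    · exact ZMod.ringHom_surjective _
  have hset : (((PadicInt.toZMod (p := p)).toAddMonoidHom.ker : AddSubgroup ℤ_[p]) : Set ℤ_[p]) =
      (fun x : ℤ_[p] => (x : ℚ_[p])) ⁻¹' Metric.closedBall 0 ‖(p : ℚ_[p])‖ := by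
    ext x
    have h1 : x ∈ RingHom.ker (PadicInt.toZMod (p := p)) ↔ ‖x‖ ≤ (p : ℝ) ^ (-(1 : ℕ) : ℤ) := by
      rw [PadicInt.norm_le_pow_iff_mem_span_pow, PadicInt.ker_toZMod,
        PadicInt.maximalIdeal_eq_span_p, pow_one]
    have h2 : x ∈ (PadicInt.toZMod (p := p)).toAddMonoidHom.ker ↔
        x ∈ RingHom.ker (PadicInt.toZMod (p := p)) := Iff.rfl
    rw [SetLike.mem_coe, h2, h1, Set.mem_preimage, mem_closedBall_zero_iff, Padic.norm_p,
      PadicInt.norm_def]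
    simp only [Nat.cast_one, zpow_neg_one]
  have : (PadicInt.toZMod (p := p)).toAddMonoidHom.ker.FiniteIndex :=
    ⟨by rw [hker]; exact hp.out.ne_zero⟩
  have hm := AddSubgroup.index_mul_measure (PadicInt.toZMod (p := p)).toAddMonoidHom.ker
    (by rw [hset]; exact (Metric.isClosed_closedBall.preimage
      (isOpenEmbedding_coe_padicInt (p := p)).continuous).measurableSet) (uniformPadicInt p)
  rw [hker, hset, measure_univ, uniformPadicInt_apply, Set.image_preimage_eq_of_subset] at hm
  · exact ENNReal.eq_inv_of_mul_eq_one_left (by rwa [mul_comm])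
  · rw [range_coe_padicInt]
    exact Metric.closedBall_subset_closedBall Padic.norm_p_lt_one.le

/-- Multiplication by `p` relates the balls of radius `‖p ^ m‖` and `‖p ^ (m + 1)‖`, so induction on
the integer `m` in both directions starts from the unit ball. Every nonzero norm is of the form `‖p
^ m‖`. -/
theorem haarPadic_closedBall_norm (a : ℚ_[p]) (ha : a ≠ 0) :
    haarPadic p (Metric.closedBall 0 ‖a‖) = ‖a‖ₑ := by
  have hp0 : (p : ℚ_[p]) ≠ 0 := by exact_mod_cast hp.out.ne_zero
  have key : ∀ m : ℤ, haarPadic p (Metric.closedBall 0 ‖(p : ℚ_[p]) ^ m‖) = ‖(p : ℚ_[p]) ^ m‖ₑ := by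
    have step : ∀ m : ℤ, haarPadic p (Metric.closedBall 0 ‖(p : ℚ_[p]) ^ (m + 1)‖) =
        ‖(p : ℚ_[p])‖ₑ * haarPadic p (Metric.closedBall 0 ‖(p : ℚ_[p]) ^ m‖) := by
      intro m
      have hpe : ‖(p : ℚ_[p])‖ₑ = (p : ℝ≥0∞)⁻¹ := by
        rw [← ofReal_norm, Padic.norm_p, ENNReal.ofReal_inv_of_pos (by exact_mod_cast hp.out.pos)]
        simp
      rw [hpe, ← haarPadic_closedBall_p, ← haarPadic_image_mul _ hp0, image_mul_closedBall _ hp0,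
        ← norm_mul, zpow_add₀ hp0, zpow_one, mul_comm]
    have hen : ∀ m : ℤ, ‖(p : ℚ_[p]) ^ (m + 1)‖ₑ = ‖(p : ℚ_[p])‖ₑ * ‖(p : ℚ_[p]) ^ m‖ₑ := by
      intro m
      rw [zpow_add₀ hp0, zpow_one, mul_comm, enorm_mul]
    have hz : ‖(p : ℚ_[p])‖ₑ ≠ 0 := by simpa using hp0
    intro m
    induction m using Int.induction_on with
    | zero => simpa using haarPadic_closedBall_one (p := p)
    | succ i hi => rw [step, hi, hen]
    | pred i hi =>
      have h1 := step (-(i : ℤ) - 1)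
      have h2 := hen (-(i : ℤ) - 1)
      rw [sub_add_cancel] at h1 h2
      rw [h1, h2] at hi
      exact (ENNReal.mul_right_inj hz enorm_ne_top).mp hi
  have hn : ‖a‖ = ‖(p : ℚ_[p]) ^ (a.valuation)‖ := by
    rw [Padic.norm_eq_zpow_neg_valuation ha, Padic.norm_p_zpow]
  have hne : ‖a‖ₑ = ‖(p : ℚ_[p]) ^ (a.valuation)‖ₑ := by
    rw [← ofReal_norm, ← ofReal_norm, hn]
  rw [hne, hn, key]

/-- A point lies in balls of measure `p ^ (-m)` for all `m`. This makes hyperplanes null, which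
settles the singular case of the determinant formula. -/
instance : NullSingletonClass (haarPadic p) := by
  refine ⟨fun x => ?_⟩
  rw [← nonpos_iff_eq_zero]
  have hx : haarPadic p {x} = haarPadic p {0} := by
    rw [← measure_preimage_add (haarPadic p) x {x}]
    congr 1
    ext y
    simp
  rw [hx]
  have hp0 : (p : ℚ_[p]) ≠ 0 := by exact_mod_cast hp.out.ne_zero
  have h : ∀ m : ℕ, haarPadic p {0} ≤ ‖(p : ℚ_[p])‖ₑ ^ m := by
    intro m
    rw [← enorm_pow, ← haarPadic_closedBall_norm _ (pow_ne_zero m hp0)]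
    exact measure_mono (by simp)
  refine ge_of_tendsto' (ENNReal.tendsto_pow_atTop_nhds_zero_of_lt_one ?_) h
  rw [← ofReal_norm]
  exact ENNReal.ofReal_lt_one.mpr Padic.norm_p_lt_one

/-! ### A matrix scales Haar measure by the absolute value of its determinant -/

section Determinant

variable {p : ℕ} [hp : Fact p.Prime] {κ : Type*} [Fintype κ]

/-- The Haar measure on `ℚ_p^κ` for which `ℤ_p^κ` has measure one. -/
noncomputable abbrev haarPi (p : ℕ) [Fact p.Prime] (κ : Type*) [Fintype κ] :
    Measure (κ → ℚ_[p]) :=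
  Measure.pi fun _ => haarPadic p

/-- The uniform distribution on `ℤ_p^κ`. -/
noncomputable abbrev uniformPi (p : ℕ) [Fact p.Prime] (κ : Type*) [Fintype κ] :
    Measure (κ → ℤ_[p]) :=
  Measure.pi fun _ => uniformPadicInt p

theorem enorm_finset_prod (b : κ → ℚ_[p]) : ‖∏ i, b i‖ₑ = ∏ i, ‖b i‖ₑ := by
  simp only [enorm_eq_nnnorm, nnnorm_prod]
  push_cast
  rfl

theorem haarPi_box (b : κ → ℚ_[p]) (hb : ∀ i, b i ≠ 0) :
    haarPi p κ (Set.univ.pi fun i => Metric.closedBall 0 ‖b i‖) = ∏ i, ‖b i‖ₑ := by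
  rw [Measure.pi_pi]
  exact Finset.prod_congr rfl fun i _ => haarPadic_closedBall_norm _ (hb i)

theorem haarPi_box_ne_zero (b : κ → ℚ_[p]) (hb : ∀ i, b i ≠ 0) :
    haarPi p κ (Set.univ.pi fun i => Metric.closedBall 0 ‖b i‖) ≠ 0 := by
  rw [haarPi_box b hb, Finset.prod_ne_zero_iff]
  intro i _
  simpa using hb i

theorem haarPi_box_ne_top (b : κ → ℚ_[p]) (hb : ∀ i, b i ≠ 0) :
    haarPi p κ (Set.univ.pi fun i => Metric.closedBall 0 ‖b i‖) ≠ ∞ := by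
  rw [haarPi_box b hb]
  exact ENNReal.prod_ne_top fun i _ => enorm_ne_top

variable [DecidableEq κ]

/-- The additive automorphism of `ℚ_p^κ` given by an invertible matrix. -/
noncomputable def mulVecEquiv (M N : Matrix κ κ ℚ_[p]) (h : M * N = 1) :
    (κ → ℚ_[p]) ≃ₜ+ (κ → ℚ_[p]) :=
  { (Matrix.toLin'OfInv (mul_eq_one_comm.mp h) h).toAddEquiv with
    continuous_toFun := LinearMap.continuous_on_pi (Matrix.toLin' M)
    continuous_invFun := LinearMap.continuous_on_pi (Matrix.toLin' N) }

theorem mulVecEquiv_apply (M N : Matrix κ κ ℚ_[p]) (h : M * N = 1) :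
    ⇑(mulVecEquiv M N h) = M.mulVec := rfl

/-- The shear adds `c * x j` to the coordinate `i`. It maps a box to itself if the side in direction
`j` has radius `‖b₀‖` with `‖c‖ * ‖b₀‖ ≤ 1`, by the ultrametric inequality; the inverse shear does
so too. The scaling constant is therefore one. -/
theorem haarPi_image_transvection (t : Matrix.TransvectionStruct κ ℚ_[p]) (s : Set (κ → ℚ_[p])) :
    haarPi p κ (t.toMatrix.mulVec '' s) = haarPi p κ s := by
  obtain ⟨i, j, hij, c⟩ := t
  obtain ⟨b₀, hb₀, hbc⟩ : ∃ b : ℚ_[p], b ≠ 0 ∧ ‖c‖ * ‖b‖ ≤ 1 := by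
    by_cases h0 : c = 0
    · exact ⟨1, one_ne_zero, by simp [h0]⟩
    · exact ⟨c⁻¹, inv_ne_zero h0, by
        rw [norm_inv, mul_inv_cancel₀ (norm_ne_zero_iff.mpr h0)]⟩
  set b : κ → ℚ_[p] := Function.update (fun _ => 1) j b₀ with hbdef
  have hb : ∀ l, b l ≠ 0 := by
    intro l
    by_cases hl : l = j
    · subst hl; simpa [hbdef] using hb₀
    · simp [hbdef, hl]
  have hmaps : ∀ a : ℚ_[p], ‖a‖ = ‖c‖ → ∀ x ∈ Set.univ.pi fun l => Metric.closedBall 0 ‖b l‖,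
      (Matrix.transvection i j a).mulVec x ∈ Set.univ.pi fun l => Metric.closedBall 0 ‖b l‖ := by
    intro a ha x hx
    simp only [Set.mem_univ_pi, mem_closedBall_zero_iff] at hx ⊢
    intro l
    rw [Matrix.transvection, Matrix.add_mulVec, Matrix.one_mulVec, Pi.add_apply,
      Matrix.single_mulVec]
    by_cases hl : l = i
    · subst hl
      have h1 : ‖b l‖ = 1 := by simp [hbdef, hij]
      rw [h1, Function.update_self]
      refine (Padic.nonarchimedean _ _).trans (max_le ((hx l).trans h1.le) ?_)
      rw [norm_mul, ha]
      have h2 : ‖x j‖ ≤ ‖b₀‖ := by simpa [hbdef] using hx j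
      calc ‖c‖ * ‖x j‖ ≤ ‖c‖ * ‖b₀‖ := by gcongr
        _ ≤ 1 := hbc
    · rw [Function.update_of_ne hl, Pi.zero_apply, add_zero]
      exact hx l
  have hinv : Matrix.transvection i j c * Matrix.transvection i j (-c) = 1 := by
    rw [Matrix.transvection_mul_transvection_same _ _ hij, add_neg_cancel,
      Matrix.transvection_zero]
  have himg : (Matrix.transvection i j c).mulVec ''
      (Set.univ.pi fun l => Metric.closedBall 0 ‖b l‖) =
      Set.univ.pi fun l => Metric.closedBall 0 ‖b l‖ := by
    refine Set.Subset.antisymm ?_ ?_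
    · rintro _ ⟨x, hx, rfl⟩
      exact hmaps c rfl x hx
    · intro x hx
      refine ⟨_, hmaps (-c) (norm_neg c) x hx, ?_⟩
      rw [Matrix.mulVec_mulVec, hinv, Matrix.one_mulVec]
  exact measure_image_eq_of_eq (haarPi p κ) (haarPi p κ) (mulVecEquiv _ _ hinv)
    (haarPi_box_ne_zero b hb) (haarPi_box_ne_top b hb)
    (by rw [mulVecEquiv_apply, himg]) s

theorem haarPi_image_diagonal (D : κ → ℚ_[p]) (s : Set (κ → ℚ_[p])) :
    haarPi p κ ((Matrix.diagonal D).mulVec '' s) =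
      ‖(Matrix.diagonal D).det‖ₑ * haarPi p κ s := by
  rw [Matrix.det_diagonal]
  by_cases hD : ∀ i, D i ≠ 0
  · have hinv : Matrix.diagonal D * Matrix.diagonal (fun i => (D i)⁻¹) = 1 := by
      rw [Matrix.diagonal_mul_diagonal, ← Matrix.diagonal_one]
      congr 1
      funext i
      exact mul_inv_cancel₀ (hD i)
    obtain ⟨c, hc⟩ := exists_measure_image_eq_mul (haarPi p κ) (haarPi p κ) (mulVecEquiv _ _ hinv)
    rw [mulVecEquiv_apply] at hc
    have himg : (Matrix.diagonal D).mulVec ''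
        (Set.univ.pi fun _ => Metric.closedBall 0 ‖(1 : ℚ_[p])‖) =
        Set.univ.pi fun l => Metric.closedBall 0 ‖D l‖ := by
      ext x
      simp only [Set.mem_image, Set.mem_univ_pi, mem_closedBall_zero_iff, norm_one]
      constructor
      · rintro ⟨y, hy, rfl⟩ l
        rw [Matrix.mulVec_diagonal, norm_mul]
        exact mul_le_of_le_one_right (norm_nonneg _) (hy l)
      · intro hx
        refine ⟨fun l => (D l)⁻¹ * x l, fun l => ?_, ?_⟩
        · rw [norm_mul, norm_inv, inv_mul_le_iff₀ (norm_pos_iff.mpr (hD l)), mul_one]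
          exact hx l
        · funext l
          rw [Matrix.mulVec_diagonal]
          exact mul_inv_cancel_left₀ (hD l) _
    have h1 := hc (Set.univ.pi fun _ => Metric.closedBall 0 ‖(1 : ℚ_[p])‖)
    rw [himg, haarPi_box D hD, haarPi_box (fun _ : κ => (1 : ℚ_[p])) (fun _ => one_ne_zero)] at h1
    simp only [enorm_one, Finset.prod_const_one, mul_one] at h1
    rw [hc, ← h1, enorm_finset_prod]
  -- If a diagonal entry vanishes, the image lies in a coordinate hyperplane.
  · push Not at hD
    obtain ⟨i, hi⟩ := hD
    rw [Finset.prod_eq_zero (Finset.mem_univ i) hi, enorm_zero, zero_mul]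
    refine measure_mono_null ?_ (Measure.pi_hyperplane (fun _ : κ => haarPadic p) i 0)
    rintro _ ⟨x, _, rfl⟩
    simp [Matrix.mulVec_diagonal, hi]

/-- The Haar measure of the image of a set under a matrix. -/
theorem haarPi_image_mulVec (M : Matrix κ κ ℚ_[p]) :
    ∀ s : Set (κ → ℚ_[p]), haarPi p κ (M.mulVec '' s) = ‖M.det‖ₑ * haarPi p κ s := by
  refine Matrix.diagonal_transvection_induction
    (fun M => ∀ s : Set (κ → ℚ_[p]), haarPi p κ (M.mulVec '' s) = ‖M.det‖ₑ * haarPi p κ s) M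
    (fun D _ s => haarPi_image_diagonal D s) (fun t s => ?_) (fun A B hA hB s => ?_)
  · rw [haarPi_image_transvection, Matrix.TransvectionStruct.det, enorm_one, one_mul]
  · have : (A * B).mulVec '' s = A.mulVec '' (B.mulVec '' s) := by
      rw [Set.image_image]
      exact Set.image_congr fun x _ => (Matrix.mulVec_mulVec x A B).symm
    rw [this, hA, hB, Matrix.det_mul, enorm_mul, mul_assoc]

/-- The inclusion of `ℤ_p^κ` in `ℚ_p^κ`. -/
def coePi (p : ℕ) [Fact p.Prime] (κ : Type*) (x : κ → ℤ_[p]) : κ → ℚ_[p] := fun i => x i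

omit [DecidableEq κ] in
theorem isOpenEmbedding_coePi : Topology.IsOpenEmbedding (coePi p κ) := by
  refine .of_continuous_injective_isOpenMap ?_ ?_ ?_
  · exact continuous_pi fun i => isOpenEmbedding_coe_padicInt.continuous.comp (continuous_apply i)
  · intro x y h
    funext i
    exact Subtype.val_injective (congrFun h i)
  · exact IsOpenMap.piMap (fun _ => isOpenEmbedding_coe_padicInt.isOpenMap)
      (by simp [Filter.cofinite_eq_bot])

omit [DecidableEq κ] in
-- Both sides are Haar probability measures on the compact group `ℤ_p^κ`, so uniqueness applies.
theorem uniformPi_apply (s : Set (κ → ℤ_[p])) :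
    uniformPi p κ s = haarPi p κ (coePi p κ '' s) := by
  have hhaar : ((haarPi p κ).comap (coePi p κ)).IsAddHaarMeasure :=
    Measure.IsAddHaarMeasure.comap (mH := inferInstance) (haarPi p κ)
      (f := ((PadicInt.Coe.ringHom (p := p)).toAddMonoidHom.compLeft κ)) isOpenEmbedding_coePi
  have happ := (isOpenEmbedding_coePi (p := p) (κ := κ)).measurableEmbedding.comap_apply
    (haarPi p κ)
  have hrange : Set.range (coePi p κ) =
      Set.univ.pi fun _ => Metric.closedBall 0 ‖(1 : ℚ_[p])‖ := by
    ext x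
    simp only [Set.mem_range, Set.mem_univ_pi, mem_closedBall_zero_iff, norm_one]
    exact ⟨fun ⟨y, hy⟩ i => hy ▸ (y i).2, fun h => ⟨fun i => ⟨x i, h i⟩, rfl⟩⟩
  have hprob : IsProbabilityMeasure ((haarPi p κ).comap (coePi p κ)) := by
    refine ⟨?_⟩
    rw [happ, Set.image_univ, hrange, haarPi_box (fun _ : κ => (1 : ℚ_[p])) fun _ => one_ne_zero]
    simp
  rw [← happ]
  exact congrArg (fun μ : Measure (κ → ℤ_[p]) => μ s)
    (Measure.isAddHaarMeasure_eq_of_isProbabilityMeasure _ _)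

/-- The uniform measure of the image of a set under a matrix with entries in `ℤ_p`. -/
theorem uniformPi_image_mulVec (M : Matrix κ κ ℤ_[p]) (s : Set (κ → ℤ_[p])) :
    uniformPi p κ (M.mulVec '' s) = ‖M.det‖ₑ * uniformPi p κ s := by
  have h1 : coePi p κ '' (M.mulVec '' s) =
      (M.map (PadicInt.Coe.ringHom (p := p))).mulVec '' (coePi p κ '' s) := by
    rw [Set.image_image, Set.image_image]
    refine Set.image_congr fun x _ => ?_
    funext i
    exact RingHom.map_mulVec (PadicInt.Coe.ringHom (p := p)) M x i
  have h2 : ‖(M.map (PadicInt.Coe.ringHom (p := p))).det‖ₑ = ‖M.det‖ₑ := by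
    rw [← RingHom.mapMatrix_apply, ← RingHom.map_det]
    rfl
  rw [uniformPi_apply, uniformPi_apply, h1, haarPi_image_mulVec, h2]

end Determinant

/-! ### Volumes of images of small balls under polynomial maps -/

section AreaLemma

open Filter Topology

/-- The linear part of a tuple of polynomials. -/
noncomputable def linearPart {R σ ι : Type*} [CommRing R] (F : ι → MvPolynomial σ R) :
    Matrix ι σ R :=
  fun i j => MvPolynomial.coeff (Finsupp.single j 1) (F i)

/-- Taylor expansion at the origin after rescaling by `t`. The remainder is `t ^ 2` times a
polynomial that may depend on `t` but has coefficients in `R`; over `ℤ_p` this integrality gives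
bounds uniform in `t`. -/
theorem exists_eval_smul_eq {R κ : Type*} [CommRing R] [Fintype κ] (t : R)
    (P : MvPolynomial κ R) :
    ∃ Q : MvPolynomial κ R, ∀ x : κ → R, MvPolynomial.eval (t • x) P =
      MvPolynomial.coeff 0 P +
        t * (∑ j, MvPolynomial.coeff (Finsupp.single j 1) P * x j + t * MvPolynomial.eval x Q) := by
  classical
  induction P using MvPolynomial.induction_on with
  | C a =>
    refine ⟨0, fun x => ?_⟩
    have h : ∀ j : κ, MvPolynomial.coeff (Finsupp.single j 1)
        (MvPolynomial.C a : MvPolynomial κ R) = 0 := by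
      intro j
      rw [MvPolynomial.coeff_C, if_neg]
      intro h
      simpa using DFunLike.congr_fun h j
    simp [h]
  | add P P' hP hP' =>
    obtain ⟨Q, hQ⟩ := hP
    obtain ⟨Q', hQ'⟩ := hP'
    refine ⟨Q + Q', fun x => ?_⟩
    simp only [map_add, hQ, hQ', MvPolynomial.coeff_add, add_mul, Finset.sum_add_distrib]
    ring
  | mul_X P i hP =>
    obtain ⟨Q, hQ⟩ := hP
    refine ⟨MvPolynomial.X i * (∑ j, MvPolynomial.C (MvPolynomial.coeff (Finsupp.single j 1) P) *
      MvPolynomial.X j + MvPolynomial.C t * Q), fun x => ?_⟩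
    have h : ∀ j : κ, MvPolynomial.coeff (Finsupp.single j 1) (P * MvPolynomial.X i) =
        if j = i then MvPolynomial.coeff 0 P else 0 := by
      intro j
      rw [MvPolynomial.coeff_mul_X']
      by_cases hj : j = i
      · subst hj; simp
      · rw [if_neg hj, if_neg]
        simpa using fun h => hj h.symm
    have h0 : MvPolynomial.coeff 0 (P * MvPolynomial.X i) = 0 := by
      rw [MvPolynomial.coeff_mul_X']
      simp
    simp only [map_mul, hQ, MvPolynomial.eval_X, Pi.smul_apply, smul_eq_mul, h, map_add, map_sum,
      MvPolynomial.eval_C, ite_mul, zero_mul, Finset.sum_ite_eq', Finset.mem_univ, if_true,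
      h0]
    ring

variable {p : ℕ} [hp : Fact p.Prime] {κ : Type*} [Fintype κ]

theorem norm_eval_sub_eval_le (Q : MvPolynomial κ ℤ_[p]) (x y : κ → ℤ_[p]) :
    ‖MvPolynomial.eval x Q - MvPolynomial.eval y Q‖ ≤ ‖x - y‖ := by
  induction Q using MvPolynomial.induction_on with
  | C a => simp
  | add P P' hP hP' =>
    rw [map_add, map_add, add_sub_add_comm]
    exact (PadicInt.nonarchimedean _ _).trans (max_le hP hP')
  | mul_X P i hP =>
    have : MvPolynomial.eval x (P * MvPolynomial.X i) - MvPolynomial.eval y (P * MvPolynomial.X i) =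
        (MvPolynomial.eval x P - MvPolynomial.eval y P) * x i +
          MvPolynomial.eval y P * (x i - y i) := by
      simp only [map_mul, MvPolynomial.eval_X]; ring
    rw [this]
    refine (PadicInt.nonarchimedean _ _).trans (max_le ?_ ?_)
    · rw [norm_mul]
      exact (mul_le_of_le_one_right (norm_nonneg _) (PadicInt.norm_le_one _)).trans hP
    · rw [norm_mul]
      exact (mul_le_of_le_one_left (norm_nonneg _) (PadicInt.norm_le_one _)).trans
        (norm_le_pi_norm (x - y) i)

theorem norm_mulVec_le (M : Matrix κ κ ℤ_[p]) (x : κ → ℤ_[p]) : ‖M.mulVec x‖ ≤ ‖x‖ := by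
  rw [pi_norm_le_iff_of_nonneg (norm_nonneg _)]
  intro i
  refine IsUltrametricDist.norm_sum_le_of_forall_le_of_nonneg (norm_nonneg _) fun j _ => ?_
  rw [norm_mul]
  exact (mul_le_of_le_one_left (norm_nonneg _) (PadicInt.norm_le_one _)).trans
    (norm_le_pi_norm x j)

/-- The polynomial map given by a tuple of polynomials. -/
noncomputable def polyMap {R σ ι : Type*} [CommRing R] (F : ι → MvPolynomial σ R) (x : σ → R) :
    ι → R :=
  fun i => MvPolynomial.eval x (F i)

/-- The vectors all of whose entries are divisible by `p ^ r`. -/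
def divSet (p : ℕ) [Fact p.Prime] (κ : Type*) (r : ℕ) : Set (κ → ℤ_[p]) :=
  {x | ∀ i, (p : ℤ_[p]) ^ r ∣ x i}

omit [Fintype κ] in
theorem divSet_eq_range (r : ℕ) : divSet p κ r = Set.range fun x => (p : ℤ_[p]) ^ r • x := by
  ext x
  constructor
  · intro h
    choose y hy using h
    exact ⟨y, funext fun i => (hy i).symm⟩
  · rintro ⟨y, rfl⟩ i
    exact ⟨y i, rfl⟩

omit [Fintype κ] in
theorem isCompact_divSet (r : ℕ) : IsCompact (divSet p κ r) := by
  rw [divSet_eq_range]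
  exact isCompact_range (continuous_const_smul _)

variable [DecidableEq κ]

/-- A perturbation of a matrix with nonzero determinant that is small with respect to the
determinant hits the whole image of the matrix. -/
theorem range_mulVec_subset_of_norm_lt (J : Matrix κ κ ℤ_[p]) (Q : κ → MvPolynomial κ ℤ_[p])
    (t : ℤ_[p]) (ht : ‖t‖ < ‖J.det‖) :
    Set.range J.mulVec ⊆ Set.range fun x => J.mulVec x + t • polyMap Q x := by
  have h0 : ‖J.det‖ ≠ 0 := ((norm_nonneg t).trans_lt ht).ne'
  have hQ0 : (J.det : ℚ_[p]) ≠ 0 := fun h => h0 (by rw [PadicInt.norm_def, h, norm_zero])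
  have hnorm : ‖(t : ℚ_[p]) / J.det‖ < 1 := by
    rw [norm_div, div_lt_one (norm_pos_iff.mpr hQ0)]
    exact ht
  -- The matrix `a • J.adjugate` is `t • J⁻¹`, and it is integral and divisible by `a`, with `‖a‖ <
  -- 1`. A fixed point of `x ↦ y - t J⁻¹ Q(x)` solves `J x + t Q(x) = J y`; this map is a
  -- contraction because polynomials over `ℤ_p` are 1-Lipschitz.
  set a : ℤ_[p] := ⟨(t : ℚ_[p]) / J.det, hnorm.le⟩ with ha
  have hat : J.det * a = t := PadicInt.ext (by
    rw [PadicInt.coe_mul]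
    exact mul_div_cancel₀ _ hQ0)
  have hJ : J * (a • J.adjugate) = t • (1 : Matrix κ κ ℤ_[p]) := by
    rw [Matrix.mul_smul, Matrix.mul_adjugate, smul_smul, mul_comm, hat]
  rintro _ ⟨y, rfl⟩
  set T : (κ → ℤ_[p]) → (κ → ℤ_[p]) := fun x => y - (a • J.adjugate).mulVec (polyMap Q x)
  have hT : ContractingWith ‖a‖₊ T := by
    refine ⟨hnorm, LipschitzWith.of_dist_le_mul fun x x' => ?_⟩
    rw [dist_eq_norm, dist_eq_norm, sub_sub_sub_cancel_left, ← Matrix.mulVec_sub,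
      Matrix.smul_mulVec, norm_smul, norm_sub_rev x x']
    refine mul_le_mul_of_nonneg_left ?_ (norm_nonneg a)
    refine (norm_mulVec_le _ _).trans ?_
    rw [pi_norm_le_iff_of_nonneg (norm_nonneg _)]
    exact fun i => norm_eval_sub_eval_le (Q i) x' x
  obtain ⟨x, hx⟩ : ∃ x, T x = x := ⟨_, hT.fixedPoint_isFixedPt⟩
  refine ⟨x, ?_⟩
  have h1 : J.mulVec (T x) = J.mulVec y - t • polyMap Q x := by
    rw [Matrix.mulVec_sub, Matrix.mulVec_mulVec, hJ, Matrix.smul_mulVec, Matrix.one_mulVec]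
  rw [hx] at h1
  simp only
  rw [h1, sub_add_cancel]

/-- The sets `J ℤ_p^κ + p ^ r ℤ_p^κ` decrease to the closure of `J ℤ_p^κ`, which is already closed
by compactness. Continuity from above and the determinant formula give the limit, also for singular
`J`. -/
theorem tendsto_measure_range_add_smul (J : Matrix κ κ ℤ_[p]) :
    Tendsto (fun r : ℕ => uniformPi p κ
      (Set.range fun z : (κ → ℤ_[p]) × (κ → ℤ_[p]) => J.mulVec z.1 + (p : ℤ_[p]) ^ r • z.2))
      atTop (𝓝 ‖J.det‖ₑ) := by
  have hJc : Continuous J.mulVec := LinearMap.continuous_on_pi J.mulVecLin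
  have hcomp : ∀ r : ℕ, IsCompact
      (Set.range fun z : (κ → ℤ_[p]) × (κ → ℤ_[p]) => J.mulVec z.1 + (p : ℤ_[p]) ^ r • z.2) :=
    fun r => isCompact_range (by fun_prop)
  have hlim := tendsto_measure_iInter_atTop (μ := uniformPi p κ)
    (fun r => (hcomp r).measurableSet.nullMeasurableSet) (antitone_nat_of_succ_le fun r => ?_)
    ⟨0, measure_ne_top _ _⟩
  · convert! hlim using 2
    rw [show (⋂ r : ℕ, Set.range fun z : (κ → ℤ_[p]) × (κ → ℤ_[p]) =>
      J.mulVec z.1 + (p : ℤ_[p]) ^ r • z.2) = J.mulVec '' Set.univ from ?_,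
      uniformPi_image_mulVec, measure_univ, mul_one]
    refine Set.Subset.antisymm (fun y hy => ?_) ?_
    · have hcl : IsClosed (J.mulVec '' Set.univ) := (isCompact_univ.image hJc).isClosed
      rw [← hcl.closure_eq, Metric.mem_closure_iff]
      intro ε hε
      obtain ⟨r, hr⟩ := PadicInt.exists_pow_neg_lt p hε
      obtain ⟨z, rfl⟩ := Set.mem_iInter.mp hy r
      refine ⟨_, ⟨z.1, trivial, rfl⟩, ?_⟩
      rw [dist_eq_norm, add_sub_cancel_left, norm_smul, PadicInt.norm_p_pow]
      refine lt_of_le_of_lt (mul_le_of_le_one_right (by positivity) ?_) hr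
      rw [pi_norm_le_iff_of_nonneg zero_le_one]
      exact fun i => PadicInt.norm_le_one _
    · rintro _ ⟨x, -, rfl⟩
      exact Set.mem_iInter.mpr fun r => ⟨(x, 0), by simp⟩
  · rintro _ ⟨z, rfl⟩
    refine ⟨(z.1, (p : ℤ_[p]) • z.2), ?_⟩
    simp only [smul_smul, pow_succ]

theorem mul_measure_image_smul (r : ℕ) (s : Set (κ → ℤ_[p])) :
    ((p : ℝ≥0∞) ^ r) ^ Fintype.card κ * uniformPi p κ ((fun x => (p : ℤ_[p]) ^ r • x) '' s) =
      uniformPi p κ s := by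
  have hpe : ‖(p : ℤ_[p])‖ₑ = (p : ℝ≥0∞)⁻¹ := by
    rw [← ofReal_norm, PadicInt.norm_p, ENNReal.ofReal_inv_of_pos (by exact_mod_cast hp.out.pos)]
    simp
  have hmul : (fun x => (p : ℤ_[p]) ^ r • x) =
      ((p : ℤ_[p]) ^ r • (1 : Matrix κ κ ℤ_[p])).mulVec := by
    funext x
    rw [Matrix.smul_mulVec, Matrix.one_mulVec]
  rw [hmul, uniformPi_image_mulVec, Matrix.det_smul, Matrix.det_one, mul_one, ← mul_assoc,
    enorm_pow, enorm_pow, hpe, ← ENNReal.inv_pow, ← ENNReal.inv_pow, ENNReal.mul_inv_cancel,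
    one_mul]
  · simp [hp.out.ne_zero]
  · exact ENNReal.pow_ne_top (ENNReal.pow_ne_top (ENNReal.natCast_ne_top p))

/-- By Taylor expansion, `F(p ^ r x) = F(0) + p ^ r (J x + p ^ r Q(x))`. The translation does not
change the measure and the factor `p ^ r` is compensated by the normalization. -/
theorem measure_polyMap_divSet (F : κ → MvPolynomial κ ℤ_[p]) (r : ℕ) :
    ∃ Q : κ → MvPolynomial κ ℤ_[p],
      ((p : ℝ≥0∞) ^ r) ^ Fintype.card κ * uniformPi p κ (polyMap F '' divSet p κ r) =
        uniformPi p κ (Set.range fun x =>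
          (linearPart F).mulVec x + (p : ℤ_[p]) ^ r • polyMap Q x) := by
  choose Q hQ using fun i => exists_eval_smul_eq ((p : ℤ_[p]) ^ r) (F i)
  refine ⟨Q, ?_⟩
  set G : (κ → ℤ_[p]) → (κ → ℤ_[p]) :=
    fun x => (linearPart F).mulVec x + (p : ℤ_[p]) ^ r • polyMap Q x
  have himg : polyMap F '' divSet p κ r =
      (fun y => (fun i => MvPolynomial.coeff 0 (F i)) + y) ''
        ((fun x => (p : ℤ_[p]) ^ r • x) '' Set.range G) := by
    rw [divSet_eq_range, ← Set.range_comp, ← Set.range_comp, ← Set.range_comp]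
    congr 1
    funext x i
    exact hQ i x
  rw [himg, Set.image_add_left, measure_preimage_add, mul_measure_image_smul]

theorem measure_polyMap_divSet_le_one (F : κ → MvPolynomial κ ℤ_[p]) (r : ℕ) :
    ((p : ℝ≥0∞) ^ r) ^ Fintype.card κ * uniformPi p κ (polyMap F '' divSet p κ r) ≤ 1 := by
  obtain ⟨Q, hQ⟩ := measure_polyMap_divSet F r
  rw [hQ]
  exact prob_le_one

/-- The image of a small ball under a polynomial map has the measure of the ball multiplied by the
absolute value of the Jacobian determinant, asymptotically. -/
theorem tendsto_measure_polyMap_divSet (F : κ → MvPolynomial κ ℤ_[p]) :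
    Tendsto (fun r : ℕ =>
      ((p : ℝ≥0∞) ^ r) ^ Fintype.card κ * uniformPi p κ (polyMap F '' divSet p κ r))
      atTop (𝓝 ‖(linearPart F).det‖ₑ) := by
  choose Q hQ using measure_polyMap_divSet F
  simp only [hQ]
  -- The rescaled image lies in `J ℤ_p^κ + p ^ r ℤ_p^κ` and, if `det J ≠ 0` and `r` is large,
  -- contains `J ℤ_p^κ`. If `det J = 0`, the lower bound is trivial.
  refine tendsto_of_tendsto_of_tendsto_of_le_of_le' tendsto_const_nhds
    (tendsto_measure_range_add_smul (linearPart F)) ?_ ?_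
  · by_cases h0 : (linearPart F).det = 0
    · simp [h0]
    · obtain ⟨s, hs⟩ := PadicInt.exists_pow_neg_lt p (norm_pos_iff.mpr h0)
      filter_upwards [eventually_ge_atTop s] with r hr
      rw [← mul_one ‖(linearPart F).det‖ₑ, ← measure_univ (μ := uniformPi p κ),
        ← uniformPi_image_mulVec, Set.image_univ]
      refine measure_mono (range_mulVec_subset_of_norm_lt _ _ _ (lt_of_le_of_lt ?_ hs))
      rw [PadicInt.norm_p_pow]
      exact zpow_le_zpow_right₀ (by exact_mod_cast hp.out.one_lt.le) (by simpa using hr)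
  · refine Eventually.of_forall fun r => measure_mono ?_
    rintro _ ⟨x, rfl⟩
    exact ⟨(x, polyMap (Q r) x), rfl⟩

end AreaLemma

/-! ### Coefficients of polynomials and linear substitutions -/

section Coefficients

variable {p : ℕ} [hp : Fact p.Prime] {n ν : ℕ} {d : Fin ν → ℕ}

/-- The coefficients of lists of homogeneous polynomials. -/
abbrev Coeffs (p : ℕ) [Fact p.Prime] (n : ℕ) {ν : ℕ} (d : Fin ν → ℕ) : Type :=
  (Σ j : Fin ν, Exps n (d j)) → ℤ_[p]

theorem coeff_polyOfCoeffs (x : Coeffs p n d) (j : Fin ν) (α : Exps n (d j)) :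
    MvPolynomial.coeff α.1 (polyOfCoeffs p n d x j).1 = x ⟨j, α⟩ := by
  classical
  simp only [polyOfCoeffs, MvPolynomial.coeff_sum, MvPolynomial.coeff_monomial]
  rw [Finset.sum_eq_single α]
  · simp
  · intro β _ hβ
    rw [if_neg fun h => hβ (Subtype.ext h)]
  · simp

/-- The linear isomorphism between lists of homogeneous polynomials and their coefficients. -/
noncomputable def coeffsEquiv (p : ℕ) [Fact p.Prime] (n : ℕ) {ν : ℕ} (d : Fin ν → ℕ) :
    Coeffs p n d ≃ₗ[ℤ_[p]] PolyList p n d where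
  toFun := polyOfCoeffs p n d
  map_add' x y := by
    funext j
    refine Subtype.ext ?_
    simp [polyOfCoeffs, Finset.sum_add_distrib]
  map_smul' c x := by
    funext j
    refine Subtype.ext ?_
    simp [polyOfCoeffs, Finset.smul_sum, MvPolynomial.smul_monomial]
  invFun f i := MvPolynomial.coeff i.2.1 (f i.1).1
  left_inv x := funext fun i => coeff_polyOfCoeffs x i.1 i.2
  right_inv f := by
    funext j
    refine Subtype.ext (MvPolynomial.ext _ _ fun α => ?_)
    by_cases hα : α ∈ Finset.finsuppAntidiag (Finset.univ : Finset (Fin (n + 1))) (d j)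
    · exact coeff_polyOfCoeffs _ j ⟨α, hα⟩
    · have h : ∀ g : PolyList p n d, MvPolynomial.coeff α (g j).1 = 0 := by
        intro g
        refine MvPolynomial.IsHomogeneous.coeff_eq_zero (g j).2 fun h => hα ?_
        rw [Finset.mem_finsuppAntidiag]
        refine ⟨?_, by simp⟩
        rw [← h, Finsupp.degree_eq_sum]
      rw [h, h]

theorem coeffsEquiv_apply (x : Coeffs p n d) : coeffsEquiv p n d x = polyOfCoeffs p n d x := rfl

/-- The linear forms given by the rows of a matrix. -/
noncomputable def rowForm {R σ τ : Type*} [CommRing R] [Fintype τ] (M : Matrix σ τ R) (i : σ) :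
    MvPolynomial τ R :=
  ∑ l, MvPolynomial.C (M i l) * MvPolynomial.X l

theorem isHomogeneous_rowForm {R σ τ : Type*} [CommRing R] [Fintype τ] (M : Matrix σ τ R) (i : σ) :
    (rowForm M i).IsHomogeneous 1 :=
  MvPolynomial.IsHomogeneous.sum _ _ _ fun _ _ =>
    (MvPolynomial.isHomogeneous_C_mul_X _ _)

theorem aeval_rowForm {R S σ τ : Type*} [CommRing R] [CommRing S] [Algebra R S] [Fintype τ]
    (M : Matrix σ τ R) (i : σ) (y : τ → S) :
    MvPolynomial.aeval y (rowForm M i) = (M.map (algebraMap R S)).mulVec y i := by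
  simp [rowForm, Matrix.mulVec, dotProduct]

/-- The substitution of the linear forms given by a matrix. -/
noncomputable def substMatrix (g : Matrix (Fin (n + 1)) (Fin (n + 1)) ℤ_[p]) :
    PolyList p n d →ₗ[ℤ_[p]] PolyList p n d where
  toFun f j := ⟨MvPolynomial.aeval (rowForm g) (f j).1, by
    simpa using MvPolynomial.IsHomogeneous.aeval (f j).2 (rowForm g) (isHomogeneous_rowForm g)⟩
  map_add' f f' := by
    funext j
    exact Subtype.ext (by simp)
  map_smul' c f := by
    funext j
    exact Subtype.ext (by simp)

theorem polyFun_substMatrix (g : Matrix (Fin (n + 1)) (Fin (n + 1)) ℤ_[p]) (f : PolyList p n d)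
    (j : Fin ν) (v : Fin (n + 1) → ℚ_[p]) :
    polyFun p n (substMatrix g f j).1 v =
      polyFun p n (f j).1 ((g.map (algebraMap ℤ_[p] ℚ_[p])).mulVec v) := by
  change MvPolynomial.aeval v (MvPolynomial.aeval (rowForm g) (f j).1) = _
  rw [← AlgHom.restrictScalars_apply ℤ_[p] (MvPolynomial.aeval (R := ℤ_[p]) v),
      ← AlgHom.comp_apply, MvPolynomial.comp_aeval]
  rw [polyFun]
  congr 2
  funext i
  exact aeval_rowForm g i v

theorem substMatrix_mul (g h : Matrix (Fin (n + 1)) (Fin (n + 1)) ℤ_[p]) (f : PolyList p n d) :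
    substMatrix g (substMatrix h f) = substMatrix (h * g) f := by
  funext j
  refine Subtype.ext ?_
  change MvPolynomial.aeval (rowForm g) (MvPolynomial.aeval (rowForm h) (f j).1) =
    MvPolynomial.aeval (rowForm (h * g)) (f j).1
  rw [← AlgHom.comp_apply, MvPolynomial.comp_aeval]
  congr 2
  funext i
  rw [aeval_rowForm]
  simp only [Matrix.mulVec, dotProduct, rowForm, Matrix.map_apply, MvPolynomial.algebraMap_eq,
    Matrix.mul_apply, map_sum, map_mul, Finset.mul_sum, Finset.sum_mul]
  rw [Finset.sum_comm]
  simp only [mul_assoc]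

theorem substMatrix_one (f : PolyList p n d) : substMatrix 1 f = f := by
  classical
  funext j
  refine Subtype.ext ?_
  change MvPolynomial.aeval (rowForm (1 : Matrix (Fin (n + 1)) (Fin (n + 1)) ℤ_[p])) (f j).1 =
    (f j).1
  have : rowForm (1 : Matrix (Fin (n + 1)) (Fin (n + 1)) ℤ_[p]) = MvPolynomial.X := by
    funext i
    simp [rowForm, Matrix.one_apply]
  rw [this, MvPolynomial.aeval_X_left_apply]

/-- The action on the coefficients of the substitution of the linear forms given by a matrix. -/
noncomputable def coeffsSubst (g : Matrix (Fin (n + 1)) (Fin (n + 1)) ℤ_[p]) :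
    Coeffs p n d →ₗ[ℤ_[p]] Coeffs p n d :=
  (coeffsEquiv p n d).symm.toLinearMap ∘ₗ substMatrix g ∘ₗ (coeffsEquiv p n d).toLinearMap

theorem polyOfCoeffs_coeffsSubst (g : Matrix (Fin (n + 1)) (Fin (n + 1)) ℤ_[p])
    (x : Coeffs p n d) :
    polyOfCoeffs p n d (coeffsSubst g x) = substMatrix g (polyOfCoeffs p n d x) :=
  (coeffsEquiv p n d).apply_symm_apply _

/-- A continuous surjective endomorphism of a compact group preserves its Haar probability measure.
Surjectivity comes from substituting `g⁻¹`. -/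
theorem measurePreserving_coeffsSubst (g : GL (Fin (n + 1)) ℤ_[p]) :
    MeasurePreserving (coeffsSubst (d := d) g.1) (uniformPi p (Σ j : Fin ν, Exps n (d j)))
      (uniformPi p (Σ j : Fin ν, Exps n (d j))) := by
  refine AddMonoidHom.measurePreserving (f := (coeffsSubst (d := d) g.1).toAddMonoidHom)
    (LinearMap.continuous_on_pi (coeffsSubst g.1)) (fun x => ?_) rfl
  refine ⟨coeffsSubst g⁻¹.1 x, (coeffsEquiv p n d).injective ?_⟩
  change polyOfCoeffs p n d (coeffsSubst g.1 (coeffsSubst g⁻¹.1 x)) = polyOfCoeffs p n d x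
  rw [polyOfCoeffs_coeffsSubst, polyOfCoeffs_coeffsSubst, substMatrix_mul, ← Units.val_mul,
    inv_mul_cancel, Units.val_one, substMatrix_one]

end Coefficients

/-! ### The section in the standard chart and its Jacobian matrix -/

section Chart

variable {p : ℕ} [hp : Fact p.Prime] {k n ν : ℕ} {d : Fin ν → ℕ}

/-- The coordinates of the section in the standard chart, as polynomials. -/
noncomputable def psiPoly (p : ℕ) [Fact p.Prime] (k n : ℕ) {ν : ℕ} (d : Fin ν → ℕ) :
    PolyList p n d →ₗ[ℤ_[p]] (CoeffIndex k d → MvPolynomial (Fin (n - k) × Fin (k + 1)) ℤ_[p]) where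
  toFun f r := MvPolynomial.coeff r.2.1
    (MvPolynomial.aeval (rowForm (graphMatrix (MvPolynomial (Fin (n - k) × Fin (k + 1)) ℤ_[p]) k n
      MvPolynomial.X)) (f r.1).1)
  map_add' f f' := by
    funext r
    simp
  map_smul' c f := by
    funext r
    simp

theorem psi_eq_aeval (f : PolyList p n d) (A : Fin (n - k) × Fin (k + 1) → ℚ_[p])
    (r : CoeffIndex k d) :
    psi p k n d f A r = MvPolynomial.aeval A (psiPoly p k n d f r) := by
  have h : chartPoly p k n (f r.1).1 A = MvPolynomial.map
      (MvPolynomial.aeval (R := ℤ_[p]) A : _ →ₐ[ℤ_[p]] ℚ_[p]).toRingHom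
      (MvPolynomial.aeval (rowForm (graphMatrix (MvPolynomial (Fin (n - k) × Fin (k + 1)) ℤ_[p]) k n
      MvPolynomial.X)) (f r.1).1) := by
    rw [MvPolynomial.map_aeval, chartPoly, MvPolynomial.aeval_def, MvPolynomial.coe_eval₂Hom]
    congr 1
    · refine RingHom.ext fun a => ?_
      rw [RingHom.comp_apply, IsScalarTower.algebraMap_apply ℤ_[p]
        (MvPolynomial (Fin (n - k) × Fin (k + 1)) ℤ_[p])
        (MvPolynomial (Fin (k + 1)) (MvPolynomial (Fin (n - k) × Fin (k + 1)) ℤ_[p])),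
      MvPolynomial.algebraMap_eq,
        MvPolynomial.map_C, IsScalarTower.algebraMap_apply ℤ_[p] ℚ_[p], MvPolynomial.algebraMap_eq]
      congr 1
      exact (MvPolynomial.aeval_C A a).symm
    · funext i
      simp only [rowForm, map_sum, map_mul, MvPolynomial.map_C, MvPolynomial.map_X]
      refine Finset.sum_congr rfl fun l _ => ?_
      congr 2
      unfold graphMatrix
      split_ifs <;> simp
  rw [psi, h, MvPolynomial.coeff_map]
  rfl

theorem psi_coePi (f : PolyList p n d) (A : Fin (n - k) × Fin (k + 1) → ℤ_[p])
    (r : CoeffIndex k d) :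
    psi p k n d f (coePi p _ A) r = (MvPolynomial.eval A (psiPoly p k n d f r) : ℤ_[p]) := by
  rw [psi_eq_aeval]
  exact MvPolynomial.aeval_algebraMap_apply ℚ_[p] A _

theorem hasFDerivAt_aeval_zero {κ : Type*} [Fintype κ] (P : MvPolynomial κ ℤ_[p]) :
    HasFDerivAt (fun A : κ → ℚ_[p] => MvPolynomial.aeval A P)
      (∑ j, ((MvPolynomial.coeff (Finsupp.single j 1) P : ℤ_[p]) : ℚ_[p]) •
        (ContinuousLinearMap.proj j : (κ → ℚ_[p]) →L[ℚ_[p]] ℚ_[p])) 0 := by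
  classical
  induction P using MvPolynomial.induction_on with
  | C a =>
    have h : ∀ j : κ, MvPolynomial.coeff (Finsupp.single j 1)
        (MvPolynomial.C a : MvPolynomial κ ℤ_[p]) = 0 := by
      intro j
      rw [MvPolynomial.coeff_C, if_neg]
      intro h
      simpa using DFunLike.congr_fun h j
    simp only [h, MvPolynomial.aeval_C]
    convert! hasFDerivAt_const (𝕜 := ℚ_[p]) (a : ℚ_[p]) (0 : κ → ℚ_[p]) using 1
    ext v
    simp
  | add P P' hP hP' =>
    simp only [map_add, MvPolynomial.coeff_add, PadicInt.coe_add]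
    convert! hP.add hP' using 1
    ext v
    simp [add_mul, Finset.sum_add_distrib]
  | mul_X P i hP =>
    have h : ∀ j : κ, MvPolynomial.coeff (Finsupp.single j 1) (P * MvPolynomial.X i) =
        if j = i then MvPolynomial.coeff 0 P else 0 := by
      intro j
      rw [MvPolynomial.coeff_mul_X']
      by_cases hj : j = i
      · subst hj; simp
      · rw [if_neg hj, if_neg]
        simpa using fun h => hj h.symm
    have h1 := hP.mul (ContinuousLinearMap.hasFDerivAt (x := 0)
      (ContinuousLinearMap.proj i : (κ → ℚ_[p]) →L[ℚ_[p]] ℚ_[p]))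
    have h0 : MvPolynomial.aeval (0 : κ → ℚ_[p]) P =
        algebraMap ℤ_[p] ℚ_[p] (MvPolynomial.coeff 0 P) := by
      rw [MvPolynomial.aeval_zero, MvPolynomial.constantCoeff_eq]
    simp only [h, map_mul, MvPolynomial.aeval_X]
    convert! h1 using 1
    ext v
    simp only [FunLike.coe_sum, Finset.sum_apply, smul_apply,
      ContinuousLinearMap.proj_apply, add_apply, h0]
    rw [Finset.sum_eq_single i (fun j _ hj => by rw [if_neg hj]; simp) (by simp), if_pos rfl]
    simp

/-- The components of `ψ_f` are polynomials over `ℤ_p`, whose derivative at the origin is given by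
their linear coefficients. This replaces the analytic Jacobian by an integral matrix. -/
theorem jacobian_zero_eq (f : PolyList p n d) :
    jacobian p k n d f 0 =
      (linearPart (psiPoly p k n d f)).map (PadicInt.Coe.ringHom (p := p)) := by
  have h : HasFDerivAt (psi p k n d f) (ContinuousLinearMap.pi fun r =>
      ∑ j, ((MvPolynomial.coeff (Finsupp.single j 1) (psiPoly p k n d f r) : ℤ_[p]) : ℚ_[p]) •
        (ContinuousLinearMap.proj j : (Fin (n - k) × Fin (k + 1) → ℚ_[p]) →L[ℚ_[p]] ℚ_[p])) 0 := by
    rw [hasFDerivAt_pi]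
    intro r
    simp only [psi_eq_aeval]
    exact hasFDerivAt_aeval_zero _
  rw [jacobian, h.fderiv]
  ext r j
  rw [LinearMap.toMatrix'_apply]
  simp only [ContinuousLinearMap.coe_coe, ContinuousLinearMap.coe_pi', FunLike.coe_sum,
    Finset.sum_apply, smul_apply, ContinuousLinearMap.proj_apply]
  rw [Finset.sum_eq_single j (fun l _ hl => by rw [Pi.single_eq_of_ne hl, smul_zero]) (by simp),
    Pi.single_eq_same, smul_eq_mul, mul_one]
  rfl

theorem enorm_det_jacobian (f : PolyList p n d)
    (e : Fin (n - k) × Fin (k + 1) ≃ CoeffIndex k d) :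
    ‖((jacobian p k n d f 0).submatrix e id).det‖ₑ =
      ‖(linearPart fun a => psiPoly p k n d f (e a)).det‖ₑ := by
  rw [jacobian_zero_eq]
  have : ((linearPart (psiPoly p k n d f)).map (PadicInt.Coe.ringHom (p := p))).submatrix e id =
      (PadicInt.Coe.ringHom (p := p)).mapMatrix (linearPart fun a => psiPoly p k n d f (e a)) := rfl
  rw [this, ← RingHom.map_det]
  rfl

/-- The lists of polynomials in the first variables, as lists of polynomials in all variables. -/
noncomputable def extendVars (hkn : k ≤ n) : PolyList p k d →ₗ[ℤ_[p]] PolyList p n d where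
  toFun f j := ⟨MvPolynomial.rename (Fin.castLE (Nat.succ_le_succ hkn)) (f j).1,
    MvPolynomial.IsHomogeneous.rename_isHomogeneous (f j).2⟩
  map_add' f f' := by
    funext j
    exact Subtype.ext (map_add _ _ _)
  map_smul' c f := by
    funext j
    exact Subtype.ext (map_smul _ _ _)

/-- The coefficients of the lists of polynomials that depend only on the first variables. -/
noncomputable def coeffsOfFlat (hkn : k ≤ n) : Coeffs p k d →ₗ[ℤ_[p]] Coeffs p n d :=
  (coeffsEquiv p n d).symm.toLinearMap ∘ₗ extendVars hkn ∘ₗ (coeffsEquiv p k d).toLinearMap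

/-- A polynomial in `x₀, …, x_k` alone does not see `A`, since the first `k + 1` entries of `(1, A)
y` are those of `y`. Adding such polynomials to `f` therefore translates `ψ_f` by a prescribed
constant. -/
theorem psiPoly_coeffsOfFlat (hkn : k ≤ n) (w : CoeffIndex k d → ℤ_[p]) (r : CoeffIndex k d) :
    psiPoly p k n d (polyOfCoeffs p n d (coeffsOfFlat hkn w)) r = MvPolynomial.C (w r) := by
  have h1 : polyOfCoeffs p n d (coeffsOfFlat hkn w) = extendVars hkn (polyOfCoeffs p k d w) :=
    (coeffsEquiv p n d).apply_symm_apply _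
  rw [h1]
  change MvPolynomial.coeff r.2.1 (MvPolynomial.aeval _ (MvPolynomial.rename _ _)) = _
  rw [MvPolynomial.aeval_rename]
  have h2 : (rowForm (graphMatrix (MvPolynomial (Fin (n - k) × Fin (k + 1)) ℤ_[p]) k n
      MvPolynomial.X)) ∘ Fin.castLE (Nat.succ_le_succ hkn) = MvPolynomial.X := by
    funext i
    have : ∀ l : Fin (k + 1), graphMatrix (MvPolynomial (Fin (n - k) × Fin (k + 1)) ℤ_[p]) k n
        MvPolynomial.X (Fin.castLE (Nat.succ_le_succ hkn) i) l = if i = l then 1 else 0 := by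
      intro l
      have hi : (Fin.castLE (Nat.succ_le_succ hkn) i).val < k + 1 := i.isLt
      rw [graphMatrix, dif_pos hi, Fin.val_castLE]
      simp only [Fin.val_inj]
    simp only [Function.comp_apply, rowForm, this]
    simp
  rw [h2, ← coeff_polyOfCoeffs w r.1 r.2]
  have h3 : ∀ P : MvPolynomial (Fin (k + 1)) ℤ_[p],
      MvPolynomial.aeval (MvPolynomial.X : Fin (k + 1) →
        MvPolynomial (Fin (k + 1)) (MvPolynomial (Fin (n - k) × Fin (k + 1)) ℤ_[p])) P =
      MvPolynomial.map MvPolynomial.C P := by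
    intro P
    have h4 : (MvPolynomial.aeval (R := ℤ_[p]) (MvPolynomial.X : Fin (k + 1) →
        MvPolynomial (Fin (k + 1)) (MvPolynomial (Fin (n - k) × Fin (k + 1)) ℤ_[p]))).toRingHom =
        MvPolynomial.map MvPolynomial.C := by
      refine MvPolynomial.ringHom_ext (fun a => ?_) (fun i => ?_)
      · rw [MvPolynomial.map_C]
        exact MvPolynomial.aeval_C _ a
      · rw [MvPolynomial.map_X]
        exact MvPolynomial.aeval_X _ i
    exact DFunLike.congr_fun h4 P
  rw [h3, MvPolynomial.coeff_map]

/-- Linearity in the coefficients, from which the continuity statements below follow. -/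
theorem psiPoly_polyOfCoeffs_eq_sum (x : Coeffs p n d) :
    psiPoly p k n d (polyOfCoeffs p n d x) =
      ∑ i, x i • psiPoly p k n d (polyOfCoeffs p n d (Pi.single i 1)) := by
  conv_lhs => rw [← coeffsEquiv_apply, pi_eq_sum_univ' x, map_sum, map_sum]
  simp only [map_smul]
  refine Finset.sum_congr rfl fun i _ => ?_
  rw [coeffsEquiv_apply]

theorem continuous_eval_psiPoly (r : CoeffIndex k d) :
    Continuous fun z : Coeffs p n d × (Fin (n - k) × Fin (k + 1) → ℤ_[p]) =>
      MvPolynomial.eval z.2 (psiPoly p k n d (polyOfCoeffs p n d z.1) r) := by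
  have h : ∀ z : Coeffs p n d × (Fin (n - k) × Fin (k + 1) → ℤ_[p]),
      MvPolynomial.eval z.2 (psiPoly p k n d (polyOfCoeffs p n d z.1) r) =
      ∑ i, z.1 i * MvPolynomial.eval z.2
        (psiPoly p k n d (polyOfCoeffs p n d (Pi.single i 1)) r) := by
    intro z
    rw [psiPoly_polyOfCoeffs_eq_sum, Finset.sum_apply, map_sum]
    simp
  refine Continuous.congr (continuous_finsetSum _ fun i _ => ?_) fun z => (h z).symm
  exact ((continuous_apply i).comp continuous_fst).mul
    ((MvPolynomial.continuous_eval _).comp continuous_snd)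

theorem continuous_coeff_psiPoly (r : CoeffIndex k d) (α : Fin (n - k) × Fin (k + 1) →₀ ℕ) :
    Continuous fun x : Coeffs p n d =>
      MvPolynomial.coeff α (psiPoly p k n d (polyOfCoeffs p n d x) r) := by
  have h : ∀ x : Coeffs p n d, MvPolynomial.coeff α (psiPoly p k n d (polyOfCoeffs p n d x) r) =
      ∑ i, x i * MvPolynomial.coeff α
        (psiPoly p k n d (polyOfCoeffs p n d (Pi.single i 1)) r) := by
    intro x
    rw [psiPoly_polyOfCoeffs_eq_sum, Finset.sum_apply, MvPolynomial.coeff_sum]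
    simp only [Pi.smul_apply, MvPolynomial.coeff_smul, smul_eq_mul]
  exact Continuous.congr (continuous_finsetSum _ fun i _ =>
    (continuous_apply i).mul continuous_const) fun x => (h x).symm

theorem continuous_det_linearPart (e : Fin (n - k) × Fin (k + 1) ≃ CoeffIndex k d) :
    Continuous fun x : Coeffs p n d =>
      (linearPart fun a => psiPoly p k n d (polyOfCoeffs p n d x) (e a)).det :=
  Continuous.matrix_det <| continuous_pi fun i => continuous_pi fun _ =>
    continuous_coeff_psiPoly (e i) _

end Chart

/-! ### The probability of a zero near the origin of the chart -/

section SmallZeros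

open Filter Topology

variable {p : ℕ} [hp : Fact p.Prime] {k n ν : ℕ} {d : Fin ν → ℕ}

/-- The lists of polynomials for which the section has a zero that is congruent to the origin of
the standard chart modulo `p ^ r`. -/
def zeroNear (p : ℕ) [Fact p.Prime] (k n : ℕ) {ν : ℕ} (d : Fin ν → ℕ) (r : ℕ) :
    Set (Coeffs p n d) :=
  {x | ∃ A ∈ divSet p (Fin (n - k) × Fin (k + 1)) r,
    polyMap (psiPoly p k n d (polyOfCoeffs p n d x)) A = 0}

/-- It is the projection to the coefficients of a closed subset of a compact space of pairs
consisting of coefficients and a zero. -/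
theorem isClosed_zeroNear (r : ℕ) : IsClosed (zeroNear p k n d r) := by
  have h : zeroNear p k n d r = Prod.fst '' ((Set.univ ×ˢ divSet p (Fin (n - k) × Fin (k + 1)) r) ∩
      {z : Coeffs p n d × (Fin (n - k) × Fin (k + 1) → ℤ_[p]) |
        polyMap (psiPoly p k n d (polyOfCoeffs p n d z.1)) z.2 = 0}) := by
    ext x
    constructor
    · rintro ⟨A, hA, hx⟩
      exact ⟨(x, A), ⟨⟨trivial, hA⟩, hx⟩, rfl⟩
    · rintro ⟨⟨x, A⟩, ⟨⟨-, hA⟩, hx⟩, rfl⟩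
      exact ⟨A, hA, hx⟩
  have hc : Continuous fun z : Coeffs p n d × (Fin (n - k) × Fin (k + 1) → ℤ_[p]) =>
      polyMap (psiPoly p k n d (polyOfCoeffs p n d z.1)) z.2 :=
    continuous_pi fun s => continuous_eval_psiPoly s
  rw [h]
  exact (((isCompact_univ.prod (isCompact_divSet r)).inter_right
    (isClosed_singleton.preimage hc)).image continuous_fst).isClosed

/-- The polynomial map that expresses the section in the standard chart. -/
noncomputable def chartMap (e : Fin (n - k) × Fin (k + 1) ≃ CoeffIndex k d) (x : Coeffs p n d)
    (a : Fin (n - k) × Fin (k + 1)) : MvPolynomial (Fin (n - k) × Fin (k + 1)) ℤ_[p] :=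
  psiPoly p k n d (polyOfCoeffs p n d x) (e a)

/-- Subtracting the polynomials with coefficients `w` turns the equation `ψ_f(A) = w` into a zero at
`A`. -/
theorem sub_coeffsOfFlat_mem_zeroNear (hkn : k ≤ n)
    (e : Fin (n - k) × Fin (k + 1) ≃ CoeffIndex k d) (x : Coeffs p n d)
    (w : Fin (n - k) × Fin (k + 1) → ℤ_[p]) (r : ℕ) :
    x - coeffsOfFlat hkn (w ∘ e.symm) ∈ zeroNear p k n d r ↔
      w ∈ polyMap (chartMap e x) '' divSet p _ r := by
  have h1 : polyOfCoeffs p n d (x - coeffsOfFlat hkn (w ∘ e.symm)) =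
      polyOfCoeffs p n d x - polyOfCoeffs p n d (coeffsOfFlat hkn (w ∘ e.symm)) :=
    map_sub (coeffsEquiv p n d) _ _
  have h2 : ∀ A : Fin (n - k) × Fin (k + 1) → ℤ_[p],
      polyMap (psiPoly p k n d (polyOfCoeffs p n d (x - coeffsOfFlat hkn (w ∘ e.symm)))) A = 0 ↔
        polyMap (chartMap e x) A = w := by
    intro A
    rw [h1, map_sub, funext_iff, funext_iff, ← e.forall_congr_right]
    refine forall_congr' fun a => ?_
    rw [polyMap, Pi.sub_apply, map_sub, psiPoly_coeffsOfFlat, MvPolynomial.eval_C, Pi.zero_apply,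
      sub_eq_zero, Function.comp_apply, e.symm_apply_apply]
    rfl
  simp only [zeroNear, Set.mem_ofPred_eq, h2, Set.mem_image]

theorem measurableSet_sub_coeffsOfFlat (hkn : k ≤ n)
    (e : Fin (n - k) × Fin (k + 1) ≃ CoeffIndex k d) (r : ℕ) :
    MeasurableSet {z : Coeffs p n d × (Fin (n - k) × Fin (k + 1) → ℤ_[p]) |
      z.1 - coeffsOfFlat hkn (z.2 ∘ e.symm) ∈ zeroNear p k n d r} := by
  have h1 : Continuous (coeffsOfFlat hkn : Coeffs p k d → Coeffs p n d) :=
    LinearMap.continuous_on_pi _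
  have h2 : Continuous fun z : Coeffs p n d × (Fin (n - k) × Fin (k + 1) → ℤ_[p]) =>
      (z.2 ∘ e.symm : Coeffs p k d) :=
    continuous_pi fun s => (continuous_apply (e.symm s)).comp continuous_snd
  exact ((isClosed_zeroNear r).preimage (continuous_fst.sub (h1.comp h2))).measurableSet

/-- Fubini on the pairs `(x, w)` such that the translate of `x` by `w` has a zero in the ball. For
fixed `w` the slice is a translate of `zeroNear`; for fixed `x` it is the image of the ball under
the chart map. -/
theorem uniformPi_zeroNear (hkn : k ≤ n) (e : Fin (n - k) × Fin (k + 1) ≃ CoeffIndex k d) (r : ℕ) :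
    uniformPi p _ (zeroNear p k n d r) =
      ∫⁻ x : Coeffs p n d, uniformPi p _ (polyMap (chartMap e x) '' divSet p _ r)
        ∂(uniformPi p _) := by
  have hm := measurableSet_sub_coeffsOfFlat (p := p) hkn e r
  have h1 := Measure.prod_apply (μ := uniformPi p (Σ j : Fin ν, Exps n (d j)))
    (ν := uniformPi p (Fin (n - k) × Fin (k + 1))) hm
  have h2 := Measure.prod_apply_symm (μ := uniformPi p (Σ j : Fin ν, Exps n (d j)))
    (ν := uniformPi p (Fin (n - k) × Fin (k + 1))) hm
  rw [h1] at h2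
  have h3 : ∀ w : Fin (n - k) × Fin (k + 1) → ℤ_[p],
      uniformPi p (Σ j : Fin ν, Exps n (d j)) ((fun x => (x, w)) ⁻¹'
        {z | z.1 - coeffsOfFlat hkn (z.2 ∘ e.symm) ∈ zeroNear p k n d r}) =
      uniformPi p _ (zeroNear p k n d r) := by
    intro w
    exact (measurePreserving_sub_right (uniformPi p (Σ j : Fin ν, Exps n (d j)))
      (coeffsOfFlat hkn (w ∘ e.symm))).measure_preimage
        (isClosed_zeroNear r).measurableSet.nullMeasurableSet
  simp only [h3, lintegral_const, measure_univ, mul_one] at h2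
  rw [← h2]
  refine lintegral_congr fun x => ?_
  congr 1
  ext w
  exact sub_coeffsOfFlat_mem_zeroNear hkn e x w r

theorem measurable_uniformPi_image_chartMap (hkn : k ≤ n)
    (e : Fin (n - k) × Fin (k + 1) ≃ CoeffIndex k d) (r : ℕ) :
    Measurable fun x : Coeffs p n d =>
      uniformPi p _ (polyMap (chartMap e x) '' divSet p _ r) := by
  have := measurable_measure_prodMk_left (ν := uniformPi p (Fin (n - k) × Fin (k + 1)))
    (measurableSet_sub_coeffsOfFlat (p := p) hkn e r)
  convert! this using 3 with x
  ext w
  exact (sub_coeffsOfFlat_mem_zeroNear hkn e x w r).symm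

/-- The probability that the section has a zero that is congruent to the origin of the chart modulo
`p ^ r` is asymptotically the measure of the ball multiplied by the expected absolute value of the
Jacobian determinant. -/
theorem tendsto_uniformPi_zeroNear (hkn : k ≤ n)
    (e : Fin (n - k) × Fin (k + 1) ≃ CoeffIndex k d) :
    Tendsto (fun r : ℕ => ((p : ℝ≥0∞) ^ r) ^ Fintype.card (Fin (n - k) × Fin (k + 1)) *
      uniformPi p _ (zeroNear p k n d r)) atTop
      (𝓝 (∫⁻ x : Coeffs p n d, ‖(linearPart (chartMap e x)).det‖ₑ ∂(uniformPi p _))) := by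
  simp only [uniformPi_zeroNear hkn e]
  simp only [← lintegral_const_mul _ (measurable_uniformPi_image_chartMap hkn e _)]
  refine tendsto_lintegral_of_dominated_convergence (fun _ => 1)
    (fun r => (measurable_uniformPi_image_chartMap hkn e r).const_mul _)
    (fun r => Eventually.of_forall fun x => measure_polyMap_divSet_le_one _ r) (by simp)
    (Eventually.of_forall fun x => tendsto_measure_polyMap_divSet _)

end SmallZeros

/-! ### The congruence subgroups -/

section Congruence

variable {p : ℕ} [hp : Fact p.Prime] {k n : ℕ}

/-- The partition of the rows and columns into the first `k + 1` ones and the others. -/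
def blockEquiv (hkn : k ≤ n) : Fin (k + 1) ⊕ Fin (n - k) ≃ Fin (n + 1) :=
  finSumFinEquiv.trans (finCongr (by omega))

theorem blockEquiv_inl_val (hkn : k ≤ n) (i : Fin (k + 1)) :
    (blockEquiv hkn (Sum.inl i)).val = i.val := by simp [blockEquiv]

theorem blockEquiv_inr_val (hkn : k ≤ n) (i : Fin (n - k)) :
    (blockEquiv hkn (Sum.inr i)).val = k + 1 + i.val := by simp [blockEquiv]

theorem isUnit_iff_toZMod_ne_zero (x : ℤ_[p]) : IsUnit x ↔ PadicInt.toZMod x ≠ 0 := by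
  rw [← not_iff_not, not_not, ← RingHom.mem_ker, PadicInt.ker_toZMod]
  exact (IsLocalRing.mem_maximalIdeal x).symm

/-- A block matrix with the lower left block divisible by `p` is invertible if and only if the
diagonal blocks are. -/
theorem isUnit_det_fromBlocks_iff {m l : Type*} [Fintype m] [DecidableEq m] [Fintype l]
    [DecidableEq l] (a : Matrix m m ℤ_[p]) (b : Matrix m l ℤ_[p]) (c : Matrix l m ℤ_[p])
    (d : Matrix l l ℤ_[p]) (hc : ∀ i j, (p : ℤ_[p]) ∣ c i j) :
    IsUnit (Matrix.fromBlocks a b c d).det ↔ IsUnit a.det ∧ IsUnit d.det := by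
  have h0 : c.map (PadicInt.toZMod (p := p)) = 0 := by
    ext i j
    obtain ⟨y, hy⟩ := hc i j
    simp [hy]
  rw [isUnit_iff_toZMod_ne_zero, isUnit_iff_toZMod_ne_zero, isUnit_iff_toZMod_ne_zero,
    RingHom.map_det, RingHom.map_det, RingHom.map_det, RingHom.mapMatrix_apply,
    Matrix.fromBlocks_map, h0, Matrix.det_fromBlocks_zero₂₁, mul_ne_zero_iff]
  rfl

/-- The subgroup of the matrices that preserve the span of the first `k + 1` basis vectors modulo
`p ^ r`. -/
def congrSubgroup (p : ℕ) [Fact p.Prime] (k n r : ℕ) : Subgroup (GL (Fin (n + 1)) ℤ_[p]) where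
  carrier := {g | (g.1.map (PadicInt.toZModPow (p := p) r)).BlockTriangular
    fun i => if i.val < k + 1 then 0 else 1}
  one_mem' := by
    simpa using Matrix.blockTriangular_one
  mul_mem' {g h} hg hh := by
    simp only [Set.mem_ofPred_eq, Units.val_mul, Matrix.map_mul] at hg hh ⊢
    exact hg.mul hh
  inv_mem' {g} hg := by
    have h1 : g.1.map (PadicInt.toZModPow (p := p) r) * g⁻¹.1.map (PadicInt.toZModPow r) = 1 := by
      rw [← Matrix.map_mul, ← Units.val_mul, mul_inv_cancel]
      simp
    have h2 : g⁻¹.1.map (PadicInt.toZModPow (p := p) r) * g.1.map (PadicInt.toZModPow r) = 1 := by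
      rw [← Matrix.map_mul, ← Units.val_mul, inv_mul_cancel]
      simp
    let _ : Invertible (g.1.map (PadicInt.toZModPow (p := p) r)) := ⟨_, h2, h1⟩
    have h3 := Matrix.blockTriangular_inv_of_blockTriangular
      (M := g.1.map (PadicInt.toZModPow r)) hg
    rwa [← Matrix.invOf_eq_nonsing_inv] at h3

theorem mem_congrSubgroup_iff (hkn : k ≤ n) {r : ℕ} {g : GL (Fin (n + 1)) ℤ_[p]} :
    g ∈ congrSubgroup p k n r ↔ ∀ (i : Fin (n - k)) (j : Fin (k + 1)),
      (p : ℤ_[p]) ^ r ∣ g.1 (blockEquiv hkn (Sum.inr i)) (blockEquiv hkn (Sum.inl j)) := by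
  have hdvd : ∀ x : ℤ_[p], PadicInt.toZModPow r x = 0 ↔ (p : ℤ_[p]) ^ r ∣ x := by
    intro x
    rw [← RingHom.mem_ker, PadicInt.ker_toZModPow, Ideal.mem_span_singleton]
  constructor
  · intro h i j
    rw [← hdvd]
    refine h ?_
    beta_reduce
    rw [blockEquiv_inl_val, blockEquiv_inr_val, if_pos j.isLt, if_neg (by omega)]
    exact Nat.zero_lt_one
  · intro h i j hij
    obtain ⟨i, rfl⟩ := (blockEquiv hkn).surjective i
    obtain ⟨j, rfl⟩ := (blockEquiv hkn).surjective j
    beta_reduce at hij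
    rcases i with i | i
    · rw [blockEquiv_inl_val, if_pos i.isLt] at hij
      exact absurd hij (Nat.not_lt_zero _)
    · rcases j with j | j
      · exact (hdvd _).mpr (h i j)
      · rw [blockEquiv_inr_val, blockEquiv_inr_val, if_neg (by omega), if_neg (by omega)] at hij
        exact absurd hij (lt_irrefl _)

/-- It contains the kernel of the reduction to a finite matrix group over `ℤ/p^r`. -/
instance finiteIndex_congrSubgroup (r : ℕ) : (congrSubgroup p k n r).FiniteIndex := by
  have : NeZero (p ^ r) := ⟨pow_ne_zero _ hp.out.ne_zero⟩
  have : Finite (Matrix.GeneralLinearGroup.map (n := Fin (n + 1))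
      (PadicInt.toZModPow (p := p) r)).range := inferInstance
  have hle : (Matrix.GeneralLinearGroup.map (n := Fin (n + 1))
      (PadicInt.toZModPow (p := p) r)).ker ≤ congrSubgroup p k n r := by
    intro g hg
    have h1 : g.1.map (PadicInt.toZModPow (p := p) r) = 1 :=
      congrArg Units.val (MonoidHom.mem_ker.mp hg)
    change (g.1.map (PadicInt.toZModPow (p := p) r)).BlockTriangular _
    rw [h1]
    exact Matrix.blockTriangular_one
  have := Subgroup.finiteIndex_ker (Matrix.GeneralLinearGroup.map (n := Fin (n + 1))
      (PadicInt.toZModPow (p := p) r))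
  exact Subgroup.finiteIndex_of_le hle

end Congruence

/-! ### Haar measure on `GL_N(ℤ_p)` -/

section Volume

variable {p : ℕ} [hp : Fact p.Prime] {N : ℕ}

instance : (haarMatrix p N).IsAddHaarMeasure :=
  Measure.pi.isAddHaarMeasure fun _ => haarPi p (Fin N)

/-- The entries of an invertible matrix over `ℤ_p`, as elements of `ℚ_p`. -/
def glCoe (p : ℕ) [Fact p.Prime] (N : ℕ) (g : GL (Fin N) ℤ_[p]) : Fin N → Fin N → ℚ_[p] :=
  fun i j => ((g.val i j : ℤ_[p]) : ℚ_[p])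

theorem range_glCoe : Set.range (glCoe p N) = glSet p N := rfl

theorem glCoe_injective : Function.Injective (glCoe p N) := by
  intro g h hgh
  refine Units.ext (Matrix.ext fun i j => ?_)
  exact Subtype.val_injective (congrFun (congrFun hgh i) j)

/-- The matrices with entries in `ℤ_p`. -/
def integralMatrices (p : ℕ) [Fact p.Prime] (N : ℕ) : Set (Fin N → Fin N → ℚ_[p]) :=
  {M | ∀ i j, ‖M i j‖ ≤ 1}

theorem mem_integralMatrices_iff {M : Fin N → Fin N → ℚ_[p]} :
    M ∈ integralMatrices p N ↔
      ∃ M' : Matrix (Fin N) (Fin N) ℤ_[p], M = fun i j => ((M' i j : ℤ_[p]) : ℚ_[p]) :=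
  ⟨fun h => ⟨fun i j => ⟨M i j, h i j⟩, rfl⟩, fun ⟨M', h⟩ i j => h ▸ (M' i j).2⟩

theorem haarMatrix_integralMatrices : haarMatrix p N (integralMatrices p N) = 1 := by
  have : integralMatrices p N =
      Set.univ.pi fun _ => Set.univ.pi fun _ => Metric.closedBall 0 1 := by
    ext M
    simp [integralMatrices]
  rw [this, haarMatrix, Measure.pi_pi]
  simp [Measure.pi_pi, haarPadic_closedBall_one]

theorem glSet_eq : glSet p N =
    integralMatrices p N ∩ {M | ‖(Matrix.of M).det‖ = 1} := by
  have hdet : ∀ M' : Matrix (Fin N) (Fin N) ℤ_[p],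
      ‖(Matrix.of fun i j => ((M' i j : ℤ_[p]) : ℚ_[p])).det‖ = ‖M'.det‖ := by
    intro M'
    have : (Matrix.of fun i j => ((M' i j : ℤ_[p]) : ℚ_[p])) =
      (PadicInt.Coe.ringHom (p := p)).mapMatrix M' := rfl
    rw [this, ← RingHom.map_det]
    rfl
  ext M
  constructor
  · rintro ⟨g, rfl⟩
    refine ⟨mem_integralMatrices_iff.mpr ⟨g.1, rfl⟩, ?_⟩
    rw [Set.mem_ofPred_eq, hdet]
    exact PadicInt.isUnit_iff.mp ((Matrix.isUnit_iff_isUnit_det _).mp g.isUnit)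
  · rintro ⟨hM, h1⟩
    obtain ⟨M', rfl⟩ := mem_integralMatrices_iff.mp hM
    rw [Set.mem_ofPred_eq, hdet] at h1
    obtain ⟨g, hg⟩ := (Matrix.isUnit_iff_isUnit_det M').mpr (PadicInt.isUnit_iff.mpr h1)
    refine ⟨g, funext fun i => funext fun j => ?_⟩
    exact congrArg (fun M : Matrix (Fin N) (Fin N) ℤ_[p] => ((M i j : ℤ_[p]) : ℚ_[p])) hg

theorem isOpen_integralMatrices : IsOpen (integralMatrices p N) := by
  simp only [integralMatrices, Set.ofPred_forall]
  refine isOpen_iInter_of_finite fun i => isOpen_iInter_of_finite fun j => ?_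
  have h : IsOpen (Metric.closedBall (0 : ℚ_[p]) 1) :=
    (IsUltrametricDist.isClopen_closedBall 0 one_ne_zero).isOpen
  have := h.preimage ((continuous_apply j).comp (continuous_apply (A := fun _ => Fin N → ℚ_[p]) i))
  simpa [Set.preimage, Function.comp_def] using this

theorem isOpen_glSet : IsOpen (glSet p N) := by
  rw [glSet_eq]
  refine isOpen_integralMatrices.inter ?_
  have h : IsOpen (Metric.sphere (0 : ℚ_[p]) 1) := IsUltrametricDist.isOpen_sphere 0 one_ne_zero
  have hc : Continuous fun M : Fin N → Fin N → ℚ_[p] => (Matrix.of M).det :=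
    Continuous.matrix_det continuous_id
  simpa [Set.preimage] using h.preimage hc

theorem measurableSet_glSet : MeasurableSet (glSet p N) := isOpen_glSet.measurableSet

theorem volGL_ne_zero : volGL p N ≠ 0 :=
  (isOpen_glSet.measure_pos _ ⟨glCoe p N 1, ⟨1, rfl⟩⟩).ne'

theorem volGL_ne_top : volGL p N ≠ ∞ := by
  refine ne_top_of_le_ne_top ENNReal.one_ne_top ?_
  rw [← haarMatrix_integralMatrices (p := p) (N := N), volGL, glSet_eq]
  exact measure_mono Set.inter_subset_left

theorem glCoe_mul (g h : GL (Fin N) ℤ_[p]) :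
    Matrix.of (glCoe p N (g * h)) = Matrix.of (glCoe p N g) * Matrix.of (glCoe p N h) :=
  Matrix.map_mul (f := PadicInt.Coe.ringHom (p := p))

theorem glCoe_one : Matrix.of (glCoe p N 1) = 1 :=
  Matrix.map_one (PadicInt.Coe.ringHom (p := p)) (map_zero _) (map_one _)

/-- The left multiplication of matrices by an element of `GL_N(ℤ_p)`. -/
noncomputable def leftMulEquiv (g : GL (Fin N) ℤ_[p]) :
    (Fin N → Fin N → ℚ_[p]) ≃ₜ+ (Fin N → Fin N → ℚ_[p]) where
  toFun M := Matrix.of (glCoe p N g) * Matrix.of M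
  invFun M := Matrix.of (glCoe p N g⁻¹) * Matrix.of M
  left_inv M := by
    change Matrix.of (glCoe p N g⁻¹) * (Matrix.of (glCoe p N g) * Matrix.of M) = M
    rw [← mul_assoc, ← glCoe_mul, inv_mul_cancel, glCoe_one, one_mul]
    rfl
  right_inv M := by
    change Matrix.of (glCoe p N g) * (Matrix.of (glCoe p N g⁻¹) * Matrix.of M) = M
    rw [← mul_assoc, ← glCoe_mul, mul_inv_cancel, glCoe_one, one_mul]
    rfl
  map_add' M M' := Matrix.mul_add _ _ _
  continuous_toFun := Continuous.matrix_mul continuous_const continuous_id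
  continuous_invFun := Continuous.matrix_mul continuous_const continuous_id

theorem leftMulEquiv_mem_integralMatrices (g : GL (Fin N) ℤ_[p]) {M : Fin N → Fin N → ℚ_[p]}
    (hM : M ∈ integralMatrices p N) : leftMulEquiv g M ∈ integralMatrices p N := by
  obtain ⟨M', rfl⟩ := mem_integralMatrices_iff.mp hM
  exact mem_integralMatrices_iff.mpr
    ⟨g.1 * M', (Matrix.map_mul (L := g.1) (M := M') (f := PadicInt.Coe.ringHom (p := p))).symm⟩

/-- The test set is the lattice of integral matrices, which is preserved by `g` and by `g⁻¹`. -/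
theorem haarMatrix_image_leftMulEquiv (g : GL (Fin N) ℤ_[p]) (s : Set (Fin N → Fin N → ℚ_[p])) :
    haarMatrix p N (leftMulEquiv g '' s) = haarMatrix p N s := by
  refine measure_image_eq_of_eq (haarMatrix p N) (haarMatrix p N) (leftMulEquiv g)
    (s₀ := integralMatrices p N) (by simp [haarMatrix_integralMatrices])
    (by simp [haarMatrix_integralMatrices]) (congrArg _ ?_) s
  refine Set.Subset.antisymm ?_ fun M hM => ?_
  · rintro _ ⟨M, hM, rfl⟩
    exact leftMulEquiv_mem_integralMatrices g hM
  · exact ⟨leftMulEquiv g⁻¹ M, leftMulEquiv_mem_integralMatrices g⁻¹ hM,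
      (leftMulEquiv g).apply_symm_apply M⟩

noncomputable instance instMeasurableSpaceGL : MeasurableSpace (GL (Fin N) ℤ_[p]) :=
  MeasurableSpace.comap (glCoe p N) inferInstance

theorem measurableEmbedding_glCoe : MeasurableEmbedding (glCoe p N) where
  injective := glCoe_injective
  measurable := comap_measurable _
  measurableSet_image' := by
    rintro _ ⟨s, hs, rfl⟩
    rw [Set.image_preimage_eq_inter_range, range_glCoe]
    exact hs.inter measurableSet_glSet

instance : MeasurableMul (GL (Fin N) ℤ_[p]) where
  measurable_const_mul g := by
    rw [← measurableEmbedding_glCoe.measurable_comp_iff]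
    convert! (leftMulEquiv g).continuous.measurable.comp measurableEmbedding_glCoe.measurable using 1
    funext x
    exact glCoe_mul g x
  measurable_mul_const g := by
    rw [← measurableEmbedding_glCoe.measurable_comp_iff]
    have h : Continuous (X := Fin N → Fin N → ℚ_[p]) (Y := Fin N → Fin N → ℚ_[p])
        fun M => Matrix.of M * Matrix.of (glCoe p N g) :=
      Continuous.matrix_mul continuous_id continuous_const
    convert! h.measurable.comp measurableEmbedding_glCoe.measurable using 1
    funext x
    exact glCoe_mul x g

/-- The Haar measure on `GL_N(ℤ_p)` induced by the Haar measure on matrices. -/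
noncomputable def haarGL (p : ℕ) [Fact p.Prime] (N : ℕ) : Measure (GL (Fin N) ℤ_[p]) :=
  (haarMatrix p N).comap (glCoe p N)

theorem haarGL_apply (s : Set (GL (Fin N) ℤ_[p])) :
    haarGL p N s = haarMatrix p N (glCoe p N '' s) :=
  measurableEmbedding_glCoe.comap_apply _ _

instance : (haarGL p N).IsMulLeftInvariant where
  map_mul_left_eq_self g := by
    ext s hs
    rw [Measure.map_apply (measurable_const_mul g) hs, haarGL_apply, haarGL_apply,
      ← haarMatrix_image_leftMulEquiv g]
    congr 1
    ext M
    constructor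
    · rintro ⟨_, ⟨x, hx, rfl⟩, rfl⟩
      exact ⟨g * x, hx, glCoe_mul g x⟩
    · rintro ⟨x, hx, rfl⟩
      refine ⟨glCoe p N (g⁻¹ * x), ⟨g⁻¹ * x, by simpa using hx, rfl⟩, ?_⟩
      refine (glCoe_mul g (g⁻¹ * x)).symm.trans ?_
      rw [mul_inv_cancel_left]
      rfl

theorem measurableSet_congrSubgroup {k n : ℕ} (hkn : k ≤ n) (r : ℕ) :
    MeasurableSet (congrSubgroup p k n r : Set (GL (Fin (n + 1)) ℤ_[p])) := by
  refine ⟨{M | ∀ (i : Fin (n - k)) (j : Fin (k + 1)),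
    ‖M (blockEquiv hkn (Sum.inr i)) (blockEquiv hkn (Sum.inl j))‖ ≤ (p : ℝ) ^ (-r : ℤ)}, ?_, ?_⟩
  · simp only [Set.ofPred_forall]
    refine MeasurableSet.iInter fun i => MeasurableSet.iInter fun j => ?_
    exact measurableSet_le (by fun_prop) measurable_const
  · ext g
    rw [SetLike.mem_coe, mem_congrSubgroup_iff hkn]
    refine forall_congr' fun i => forall_congr' fun j => ?_
    rw [← Ideal.mem_span_singleton, ← PadicInt.norm_le_pow_iff_mem_span_pow]
    rfl

/-- The cosets have equal measure by left invariance and partition the group. -/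
theorem index_congrSubgroup_mul {k n : ℕ} (hkn : k ≤ n) (r : ℕ) :
    (congrSubgroup p k n r).index * haarGL p (n + 1) (congrSubgroup p k n r) = volGL p (n + 1) := by
  rw [Subgroup.index_mul_measure _ (measurableSet_congrSubgroup hkn r), haarGL_apply,
    Set.image_univ, range_glCoe, volGL]

end Volume

/-! ### The index of the congruence subgroups from block volumes -/

section BlockVolume

variable {p : ℕ} [hp : Fact p.Prime] {k n : ℕ}

/-- The diagonal and the off-diagonal blocks of a matrix. -/
abbrev Blocks (p : ℕ) [Fact p.Prime] (k n : ℕ) : Type :=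
  ((Fin (k + 1) → Fin (k + 1) → ℚ_[p]) × (Fin (n - k) → Fin (n - k) → ℚ_[p])) ×
    ((Fin (k + 1) × Fin (n - k) → ℚ_[p]) × (Fin (n - k) × Fin (k + 1) → ℚ_[p]))

/-- The product of the Haar measures on the blocks. -/
noncomputable def haarBlocks (p : ℕ) [Fact p.Prime] (k n : ℕ) : Measure (Blocks p k n) :=
  ((haarMatrix p (k + 1)).prod (haarMatrix p (n - k))).prod ((haarPi p _).prod (haarPi p _))

instance : SigmaFinite (haarMatrix p n) :=
  inferInstanceAs (SigmaFinite (Measure.pi fun _ : Fin n => haarPi p (Fin n)))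

instance : (haarBlocks p k n).IsAddHaarMeasure := by
  have h1 : ((haarMatrix p (k + 1)).prod (haarMatrix p (n - k))).IsAddHaarMeasure :=
    Measure.prod.instIsAddHaarMeasure _ _
  have h2 : ((haarPi p (Fin (k + 1) × Fin (n - k))).prod
    (haarPi p (Fin (n - k) × Fin (k + 1)))).IsAddHaarMeasure :=
    Measure.prod.instIsAddHaarMeasure _ _
  exact Measure.prod.instIsAddHaarMeasure _ _

/-- The assembly of a matrix from its blocks. -/
def assemble (hkn : k ≤ n) : Blocks p k n ≃ₜ+ (Fin (n + 1) → Fin (n + 1) → ℚ_[p]) where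
  toFun z i j := Matrix.fromBlocks (Matrix.of z.1.1) (Matrix.of fun i j => z.2.1 (i, j))
    (Matrix.of fun i j => z.2.2 (i, j)) (Matrix.of z.1.2)
    ((blockEquiv hkn).symm i) ((blockEquiv hkn).symm j)
  invFun M := ((fun i j => M (blockEquiv hkn (Sum.inl i)) (blockEquiv hkn (Sum.inl j)),
      fun i j => M (blockEquiv hkn (Sum.inr i)) (blockEquiv hkn (Sum.inr j))),
    (fun a => M (blockEquiv hkn (Sum.inl a.1)) (blockEquiv hkn (Sum.inr a.2)),
      fun a => M (blockEquiv hkn (Sum.inr a.1)) (blockEquiv hkn (Sum.inl a.2))))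
  left_inv z := by simp
  right_inv M := by
    funext i j
    obtain ⟨i, rfl⟩ := (blockEquiv hkn).surjective i
    obtain ⟨j, rfl⟩ := (blockEquiv hkn).surjective j
    rcases i with i | i <;> rcases j with j | j <;> simp
  map_add' z z' := by
    funext i j
    obtain ⟨i, rfl⟩ := (blockEquiv hkn).surjective i
    obtain ⟨j, rfl⟩ := (blockEquiv hkn).surjective j
    rcases i with i | i <;> rcases j with j | j <;> simp
  continuous_toFun := by
    refine continuous_pi fun i => continuous_pi fun j => ?_
    obtain ⟨i, rfl⟩ := (blockEquiv hkn).surjective i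
    obtain ⟨j, rfl⟩ := (blockEquiv hkn).surjective j
    rcases i with i | i <;> rcases j with j | j <;> simp <;> fun_prop
  continuous_invFun := by fun_prop

theorem assemble_apply (hkn : k ≤ n) (z : Blocks p k n) (i j : Fin (k + 1) ⊕ Fin (n - k)) :
    assemble hkn z (blockEquiv hkn i) (blockEquiv hkn j) =
      Matrix.fromBlocks (Matrix.of z.1.1) (Matrix.of fun i j => z.2.1 (i, j))
        (Matrix.of fun i j => z.2.2 (i, j)) (Matrix.of z.1.2) i j := by
  change Matrix.fromBlocks _ _ _ _ _ _ = _
  rw [Equiv.symm_apply_apply, Equiv.symm_apply_apply]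

theorem assemble_mem_integralMatrices_iff (hkn : k ≤ n) (z : Blocks p k n) :
    assemble hkn z ∈ integralMatrices p (n + 1) ↔
      z ∈ (integralMatrices p (k + 1) ×ˢ integralMatrices p (n - k)) ×ˢ
        (Set.range (coePi p (Fin (k + 1) × Fin (n - k))) ×ˢ
          Set.range (coePi p (Fin (n - k) × Fin (k + 1)))) := by
  have hr : ∀ {ι : Type} (x : ι → ℚ_[p]), x ∈ Set.range (coePi p ι) ↔ ∀ i, ‖x i‖ ≤ 1 :=
    fun x => ⟨fun ⟨y, hy⟩ i => hy ▸ (y i).2, fun h => ⟨fun i => ⟨x i, h i⟩, rfl⟩⟩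
  simp only [Set.mem_prod, hr, integralMatrices, Set.mem_ofPred_eq, Prod.forall]
  simp only [← (blockEquiv hkn).forall_congr_right, assemble_apply, Sum.forall,
    Matrix.fromBlocks_apply₁₁, Matrix.fromBlocks_apply₁₂, Matrix.fromBlocks_apply₂₁,
    Matrix.fromBlocks_apply₂₂, Matrix.of_apply, forall_and]
  tauto

theorem haarBlocks_prod (s₁ : Set (Fin (k + 1) → Fin (k + 1) → ℚ_[p]))
    (s₂ : Set (Fin (n - k) → Fin (n - k) → ℚ_[p])) (s₃ : Set (Fin (k + 1) × Fin (n - k) → ℚ_[p]))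
    (s₄ : Set (Fin (n - k) × Fin (k + 1) → ℚ_[p])) :
    haarBlocks p k n ((s₁ ×ˢ s₂) ×ˢ (s₃ ×ˢ s₄)) =
      haarMatrix p (k + 1) s₁ * haarMatrix p (n - k) s₂ * (haarPi p _ s₃ * haarPi p _ s₄) := by
  rw [haarBlocks, Measure.prod_prod, Measure.prod_prod, Measure.prod_prod]

theorem haarPi_range_coePi {κ : Type*} [Fintype κ] : haarPi p κ (Set.range (coePi p κ)) = 1 := by
  classical
  rw [← Set.image_univ, ← uniformPi_apply, measure_univ]

theorem haarMatrix_image_assemble (hkn : k ≤ n) (s : Set (Blocks p k n)) :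
    haarMatrix p (n + 1) (assemble hkn '' s) = haarBlocks p k n s := by
  have h1 : haarBlocks p k n ((integralMatrices p (k + 1) ×ˢ integralMatrices p (n - k)) ×ˢ
        (Set.range (coePi p (Fin (k + 1) × Fin (n - k))) ×ˢ
          Set.range (coePi p (Fin (n - k) × Fin (k + 1))))) = 1 := by
    rw [haarBlocks_prod, haarMatrix_integralMatrices, haarMatrix_integralMatrices,
      haarPi_range_coePi, haarPi_range_coePi]
    simp
  refine measure_image_eq_of_eq (haarBlocks p k n) (haarMatrix p (n + 1)) (assemble hkn)
    (h1 ▸ one_ne_zero) (h1 ▸ ENNReal.one_ne_top) ?_ s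
  rw [h1, ← haarMatrix_integralMatrices (p := p) (N := n + 1)]
  congr 1
  ext M
  obtain ⟨z, rfl⟩ := (assemble hkn).surjective M
  rw [assemble_mem_integralMatrices_iff, Set.mem_image]
  exact ⟨fun ⟨z', hz', h⟩ => (assemble hkn).injective h ▸ hz', fun h => ⟨z, h, rfl⟩⟩

theorem haarPi_image_divSet {κ : Type*} [Fintype κ] (r : ℕ) :
    ((p : ℝ≥0∞) ^ r) ^ Fintype.card κ * haarPi p κ (coePi p κ '' divSet p κ r) = 1 := by
  classical
  rw [← uniformPi_apply, divSet_eq_range, ← Set.image_univ, mul_measure_image_smul, measure_univ]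

/-- For `r ≥ 1` the lower left block vanishes modulo `p`, so invertibility only concerns the
diagonal blocks and leaves the upper right block free. This turns the subgroup into a product set.
-/
theorem image_congrSubgroup (hkn : k ≤ n) {r : ℕ} (hr : 1 ≤ r) :
    glCoe p (n + 1) '' (congrSubgroup p k n r) = assemble hkn ''
      ((glSet p (k + 1) ×ˢ glSet p (n - k)) ×ˢ (Set.range (coePi p (Fin (k + 1) × Fin (n - k))) ×ˢ
        (coePi p _ '' divSet p (Fin (n - k) × Fin (k + 1)) r))) := by
  have hdvd : (p : ℤ_[p]) ∣ (p : ℤ_[p]) ^ r := dvd_pow_self _ (by omega)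
  ext M
  constructor
  · rintro ⟨g, hg, rfl⟩
    rw [SetLike.mem_coe, mem_congrSubgroup_iff hkn] at hg
    have h21 : ∀ i j, (p : ℤ_[p]) ∣
        (g.1.submatrix (blockEquiv hkn) (blockEquiv hkn)).toBlocks₂₁ i j :=
      fun i j => hdvd.trans (hg i j)
    have hu : IsUnit ((g.1.submatrix (blockEquiv hkn) (blockEquiv hkn)).det) := by
      rw [Matrix.det_submatrix_equiv_self]
      exact (Matrix.isUnit_iff_isUnit_det _).mp g.isUnit
    rw [← Matrix.fromBlocks_toBlocks (g.1.submatrix (blockEquiv hkn) (blockEquiv hkn)),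
      isUnit_det_fromBlocks_iff _ _ _ _ h21,
      ← Matrix.isUnit_iff_isUnit_det, ← Matrix.isUnit_iff_isUnit_det] at hu
    obtain ⟨⟨a, ha⟩, ⟨d, hd⟩⟩ := hu
    refine ⟨((glCoe p _ a, glCoe p _ d), (coePi p _ fun i =>
      g.1 (blockEquiv hkn (Sum.inl i.1)) (blockEquiv hkn (Sum.inr i.2)),
      coePi p _ fun i => g.1 (blockEquiv hkn (Sum.inr i.1)) (blockEquiv hkn (Sum.inl i.2)))),
      ⟨⟨⟨a, rfl⟩, ⟨d, rfl⟩⟩, ⟨⟨_, rfl⟩, ⟨_, fun i => hg i.1 i.2, rfl⟩⟩⟩, ?_⟩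
    funext i j
    obtain ⟨i, rfl⟩ := (blockEquiv hkn).surjective i
    obtain ⟨j, rfl⟩ := (blockEquiv hkn).surjective j
    rw [assemble_apply]
    rcases i with i | i <;> rcases j with j | j <;>
      simp [glCoe, ha, hd, coePi, Matrix.toBlocks₁₁, Matrix.toBlocks₂₂]
  · rintro ⟨⟨⟨_, _⟩, ⟨_, _⟩⟩, ⟨⟨⟨a, rfl⟩, ⟨d, rfl⟩⟩, ⟨⟨b, rfl⟩, ⟨c, hc, rfl⟩⟩⟩, rfl⟩
    have hu : IsUnit (Matrix.fromBlocks a.1 (Matrix.of fun i j => b (i, j))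
        (Matrix.of fun i j => c (i, j)) d.1).det := by
      rw [isUnit_det_fromBlocks_iff _ _ (Matrix.of fun i j => c (i, j)) _
        fun i j => hdvd.trans (hc (i, j)),
        ← Matrix.isUnit_iff_isUnit_det, ← Matrix.isUnit_iff_isUnit_det]
      exact ⟨a.isUnit, d.isUnit⟩
    rw [← Matrix.det_submatrix_equiv_self (blockEquiv hkn).symm,
      ← Matrix.isUnit_iff_isUnit_det] at hu
    obtain ⟨g, hg⟩ := hu
    have hg' : ∀ i j, g.1 (blockEquiv hkn i) (blockEquiv hkn j) =
        Matrix.fromBlocks a.1 (Matrix.of fun i j => b (i, j))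
        (Matrix.of fun i j => c (i, j)) d.1 i j := by
      intro i j
      rw [hg, Matrix.submatrix_apply, Equiv.symm_apply_apply, Equiv.symm_apply_apply]
    refine ⟨g, ?_, ?_⟩
    · rw [SetLike.mem_coe, mem_congrSubgroup_iff hkn]
      intro i j
      rw [hg']
      exact hc (i, j)
    · funext i j
      obtain ⟨i, rfl⟩ := (blockEquiv hkn).surjective i
      obtain ⟨j, rfl⟩ := (blockEquiv hkn).surjective j
      rw [assemble_apply, glCoe, hg']
      rcases i with i | i <;> rcases j with j | j <;>
        simp [coePi]

/-- Divide the volume of the whole group by that of the product set; its lower left factor has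
volume `p ^ (-r |κ|)`. -/
theorem index_congrSubgroup_eq (hkn : k ≤ n) {r : ℕ} (hr : 1 ≤ r) :
    ((congrSubgroup p k n r).index : ℝ≥0∞) =
      ((p : ℝ≥0∞) ^ r) ^ Fintype.card (Fin (n - k) × Fin (k + 1)) *
        (volGL p (n + 1) / (volGL p (k + 1) * volGL p (n - k))) := by
  have h1 := index_congrSubgroup_mul (p := p) hkn r
  rw [haarGL_apply, image_congrSubgroup hkn hr, haarMatrix_image_assemble, haarBlocks_prod,
    haarPi_range_coePi, one_mul] at h1
  have h2 := haarPi_image_divSet (p := p) (κ := Fin (n - k) × Fin (k + 1)) r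
  change _ * (volGL p (k + 1) * volGL p (n - k) * _) = _ at h1
  have h0 : volGL p (k + 1) * volGL p (n - k) ≠ 0 := mul_ne_zero volGL_ne_zero volGL_ne_zero
  have ht : volGL p (k + 1) * volGL p (n - k) ≠ ∞ := ENNReal.mul_ne_top volGL_ne_top volGL_ne_top
  rw [← h1, ← mul_div_assoc, ENNReal.eq_div_iff h0 ht]
  calc _ = volGL p (k + 1) * volGL p (n - k) * (congrSubgroup p k n r).index * 1 := by ring
    _ = _ := by rw [← h2]; ring

end BlockVolume

/-! ### Flats as cosets, and the chart near the base flat -/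

section Flats

variable {p : ℕ} [hp : Fact p.Prime] {k n : ℕ}

theorem graphMatrix_inl {R : Type} [CommRing R] (hkn : k ≤ n) (A : Fin (n - k) × Fin (k + 1) → R)
    (i j : Fin (k + 1)) :
    graphMatrix R k n A (blockEquiv hkn (Sum.inl i)) j = if i = j then 1 else 0 := by
  rw [graphMatrix, dif_pos (by rw [blockEquiv_inl_val]; exact i.isLt), blockEquiv_inl_val]
  simp only [Fin.val_inj]

theorem graphMatrix_inr {R : Type} [CommRing R] (hkn : k ≤ n) (A : Fin (n - k) × Fin (k + 1) → R)
    (i : Fin (n - k)) (j : Fin (k + 1)) :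
    graphMatrix R k n A (blockEquiv hkn (Sum.inr i)) j = A (i, j) := by
  rw [graphMatrix, dif_neg (by rw [blockEquiv_inr_val]; omega)]
  congr 2
  refine Fin.ext ?_
  simp [blockEquiv_inr_val]

/-- The flat spanned by the first `k + 1` columns of an invertible matrix over `ℤ_p`. -/
noncomputable def flat (hkn : k ≤ n) (g : GL (Fin (n + 1)) ℤ_[p]) : Grass p k n :=
  grassMap p k n hkn ⟨glCoe p (n + 1) g, ⟨g, rfl⟩⟩

theorem mem_flat_iff (hkn : k ≤ n) (g : GL (Fin (n + 1)) ℤ_[p]) (v : Fin (n + 1) → ℚ_[p]) :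
    v ∈ (flat hkn g).1 ↔ ∃ w : Fin (n + 1) → ℚ_[p], (∀ i, w (blockEquiv hkn (Sum.inr i)) = 0) ∧
      (Matrix.of (glCoe p (n + 1) g)).mulVec w = v := by
  change v ∈ LinearMap.range (Matrix.of (glCoe p (n + 1) g) * graphMatrix ℚ_[p] k n 0).mulVecLin ↔ _
  rw [LinearMap.mem_range]
  constructor
  · rintro ⟨y, rfl⟩
    refine ⟨(graphMatrix ℚ_[p] k n 0).mulVec y, fun i => ?_, ?_⟩
    · simp [Matrix.mulVec, dotProduct, graphMatrix_inr]
    · rw [Matrix.mulVecLin_apply, Matrix.mulVec_mulVec]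
  · rintro ⟨w, hw, rfl⟩
    refine ⟨fun j => w (blockEquiv hkn (Sum.inl j)), ?_⟩
    rw [Matrix.mulVecLin_apply, ← Matrix.mulVec_mulVec]
    congr 1
    funext i
    obtain ⟨i, rfl⟩ := (blockEquiv hkn).surjective i
    rcases i with i | i
    · simp [Matrix.mulVec, dotProduct, graphMatrix_inl]
    · simp [Matrix.mulVec, dotProduct, graphMatrix_inr, hw]

theorem mulVec_glCoe_mul (g h : GL (Fin (n + 1)) ℤ_[p]) (v : Fin (n + 1) → ℚ_[p]) :
    (Matrix.of (glCoe p (n + 1) (g * h))).mulVec v =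
      (Matrix.of (glCoe p (n + 1) g)).mulVec ((Matrix.of (glCoe p (n + 1) h)).mulVec v) := by
  rw [glCoe_mul, Matrix.mulVec_mulVec]

theorem mem_flat_mul_iff (hkn : k ≤ n) (g h : GL (Fin (n + 1)) ℤ_[p]) (v : Fin (n + 1) → ℚ_[p]) :
    v ∈ (flat hkn (g * h)).1 ↔
      ∃ w ∈ (flat hkn h).1, (Matrix.of (glCoe p (n + 1) g)).mulVec w = v := by
  simp only [mem_flat_iff, mulVec_glCoe_mul]
  constructor
  · rintro ⟨w, hw, rfl⟩
    exact ⟨_, ⟨w, hw, rfl⟩, rfl⟩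
  · rintro ⟨_, ⟨w, hw, rfl⟩, rfl⟩
    exact ⟨w, hw, rfl⟩

theorem flat_mul_congr (hkn : k ≤ n) (g : GL (Fin (n + 1)) ℤ_[p]) {h h' : GL (Fin (n + 1)) ℤ_[p]}
    (heq : flat hkn h = flat hkn h') : flat hkn (g * h) = flat hkn (g * h') := by
  refine Subtype.ext (Submodule.ext fun v => ?_)
  rw [mem_flat_mul_iff, mem_flat_mul_iff, heq]

theorem flat_eq_one_of_blocks (hkn : k ≤ n) {s : GL (Fin (n + 1)) ℤ_[p]}
    (hs : ∀ i j, s.1 (blockEquiv hkn (Sum.inr i)) (blockEquiv hkn (Sum.inl j)) = 0) :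
    flat hkn s = flat hkn 1 := by
  refine Subtype.ext (Submodule.eq_of_le_of_finrank_eq (fun v hv => ?_) ?_)
  · rw [mem_flat_iff] at hv ⊢
    obtain ⟨w, hw, rfl⟩ := hv
    refine ⟨_, fun i => ?_, by rw [glCoe_one, Matrix.one_mulVec]⟩
    rw [Matrix.mulVec, dotProduct, ← (blockEquiv hkn).sum_comp, Fintype.sum_sum_type]
    simp [hw, glCoe, hs]
  · rw [(flat hkn s).2, (flat hkn 1).2]

/-- The matrix `g⁻¹ * g'` stabilizes the span of the first `k + 1` basis vectors. In particular `g`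
and `g'` lie in the same coset of every congruence subgroup. -/
theorem blocks_eq_zero_of_flat_eq (hkn : k ≤ n) {g g' : GL (Fin (n + 1)) ℤ_[p]}
    (h : flat hkn g = flat hkn g') (i : Fin (n - k)) (j : Fin (k + 1)) :
    (g⁻¹ * g').1 (blockEquiv hkn (Sum.inr i)) (blockEquiv hkn (Sum.inl j)) = 0 := by
  have h1 : flat hkn (g⁻¹ * g') = flat hkn 1 := by
    rw [← flat_mul_congr hkn g⁻¹ h, inv_mul_cancel]
  have h2 : (Matrix.of (glCoe p (n + 1) (g⁻¹ * g'))).mulVec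
      (Pi.single (blockEquiv hkn (Sum.inl j)) 1) ∈ (flat hkn (g⁻¹ * g')).1 := by
    rw [mem_flat_iff]
    exact ⟨_, fun i => Pi.single_eq_of_ne (by simp) _, rfl⟩
  rw [h1, mem_flat_iff] at h2
  obtain ⟨w, hw, hw'⟩ := h2
  rw [glCoe_one, Matrix.one_mulVec] at hw'
  have h3 := hw i
  rw [hw', Matrix.mulVec_single_one] at h3
  exact PadicInt.ext h3

/-- The unipotent matrix with a given lower left block. -/
noncomputable def unipotentMatrix (hkn : k ≤ n) (A : Fin (n - k) × Fin (k + 1) → ℤ_[p]) :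
    Matrix (Fin (n + 1)) (Fin (n + 1)) ℤ_[p] :=
  (Matrix.fromBlocks 1 0 (Matrix.of fun i j => A (i, j)) 1).submatrix (blockEquiv hkn).symm
    (blockEquiv hkn).symm

theorem unipotentMatrix_mul_neg (hkn : k ≤ n) (A : Fin (n - k) × Fin (k + 1) → ℤ_[p]) :
    unipotentMatrix hkn A * unipotentMatrix hkn (-A) = 1 := by
  rw [unipotentMatrix, unipotentMatrix, Matrix.submatrix_mul_equiv, Matrix.fromBlocks_multiply]
  have : Matrix.of (fun i j => (-A) (i, j)) = -Matrix.of fun i j => A (i, j) := rfl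
  rw [this]
  simp only [mul_one, Matrix.one_mul, Matrix.mul_one, Matrix.zero_mul, Matrix.mul_zero,
    add_zero, zero_add, add_neg_cancel, Matrix.fromBlocks_one, Matrix.submatrix_one_equiv]

/-- The unipotent element of `GL_{n+1}(ℤ_p)` with a given lower left block. -/
noncomputable def unipotent (hkn : k ≤ n) (A : Fin (n - k) × Fin (k + 1) → ℤ_[p]) :
    GL (Fin (n + 1)) ℤ_[p] where
  val := unipotentMatrix hkn A
  inv := unipotentMatrix hkn (-A)
  val_inv := unipotentMatrix_mul_neg hkn A
  inv_val := by simpa using unipotentMatrix_mul_neg hkn (-A)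

theorem unipotent_val_apply (hkn : k ≤ n) (A : Fin (n - k) × Fin (k + 1) → ℤ_[p])
    (i j : Fin (k + 1) ⊕ Fin (n - k)) :
    (unipotent hkn A).1 (blockEquiv hkn i) (blockEquiv hkn j) =
      Matrix.fromBlocks 1 0 (Matrix.of fun i j => A (i, j)) 1 i j := by
  simp [unipotent, unipotentMatrix]

theorem unipotent_inv_val_apply (hkn : k ≤ n) (A : Fin (n - k) × Fin (k + 1) → ℤ_[p])
    (i j : Fin (k + 1) ⊕ Fin (n - k)) :
    (unipotent hkn A)⁻¹.1 (blockEquiv hkn i) (blockEquiv hkn j) =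
      Matrix.fromBlocks 1 0 (Matrix.of fun i j => (-A) (i, j)) 1 i j := by
  change unipotentMatrix hkn (-A) _ _ = _
  simp [unipotentMatrix]

theorem unipotent_mem_congrSubgroup (hkn : k ≤ n) {r : ℕ} {A : Fin (n - k) × Fin (k + 1) → ℤ_[p]}
    (hA : A ∈ divSet p _ r) : unipotent hkn A ∈ congrSubgroup p k n r := by
  rw [mem_congrSubgroup_iff hkn]
  intro i j
  rw [unipotent_val_apply]
  exact hA (i, j)

theorem flat_unipotent (hkn : k ≤ n) (A : Fin (n - k) × Fin (k + 1) → ℤ_[p]) :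
    flat hkn (unipotent hkn A) = chartInv p k n hkn (coePi p _ A) := by
  have h : Matrix.of (glCoe p (n + 1) (unipotent hkn A)) * graphMatrix ℚ_[p] k n 0 =
      graphMatrix ℚ_[p] k n (coePi p _ A) := by
    ext i j
    obtain ⟨i, rfl⟩ := (blockEquiv hkn).surjective i
    rw [Matrix.mul_apply, ← (blockEquiv hkn).sum_comp, Fintype.sum_sum_type]
    simp only [Matrix.of_apply, glCoe, unipotent_val_apply, graphMatrix_inl, graphMatrix_inr]
    rcases i with i | i
    · rw [graphMatrix_inl]
      by_cases h : i = j <;> simp [Matrix.one_apply, h]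
    · rw [graphMatrix_inr]
      simp [coePi]
  refine Subtype.ext ?_
  change LinearMap.range (Matrix.of (glCoe p (n + 1) (unipotent hkn A)) *
    graphMatrix ℚ_[p] k n 0).mulVecLin = _
  rw [h]
  rfl

/-- With first block column `(a, c)`, the block `a` is invertible because `c` vanishes modulo `p`,
and the columns of `(a, c)` and `(1, c a⁻¹)` have the same span. Thus `A = c a⁻¹`, still divisible
by `p ^ r`. -/
theorem exists_flat_eq_flat_unipotent (hkn : k ≤ n) {r : ℕ} (hr : 1 ≤ r)
    {h : GL (Fin (n + 1)) ℤ_[p]} (hh : h ∈ congrSubgroup p k n r) :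
    ∃ A ∈ divSet p (Fin (n - k) × Fin (k + 1)) r, flat hkn h = flat hkn (unipotent hkn A) := by
  rw [mem_congrSubgroup_iff hkn] at hh
  have hdvd : (p : ℤ_[p]) ∣ (p : ℤ_[p]) ^ r := dvd_pow_self _ (by omega)
  set H := h.1.submatrix (blockEquiv hkn) (blockEquiv hkn) with hH
  have hu : IsUnit H.det := by
    rw [hH, Matrix.det_submatrix_equiv_self]
    exact (Matrix.isUnit_iff_isUnit_det _).mp h.isUnit
  have h21 : ∀ i j, (p : ℤ_[p]) ∣ H.toBlocks₂₁ i j := fun i j => hdvd.trans (hh i j)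
  rw [← Matrix.fromBlocks_toBlocks H, isUnit_det_fromBlocks_iff _ _ _ _ h21] at hu
  refine ⟨fun a => (H.toBlocks₂₁ * H.toBlocks₁₁⁻¹) a.1 a.2, fun a => ?_, ?_⟩
  · change _ ∣ ∑ l, H.toBlocks₂₁ a.1 l * H.toBlocks₁₁⁻¹ l a.2
    exact Finset.dvd_sum fun l _ => Dvd.dvd.mul_right (hh a.1 l) _
  · set A : Fin (n - k) × Fin (k + 1) → ℤ_[p] :=
      fun a => (H.toBlocks₂₁ * H.toBlocks₁₁⁻¹) a.1 a.2 with hA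
    have hz : ∀ i j, ((unipotent hkn A)⁻¹ * h).1 (blockEquiv hkn (Sum.inr i))
        (blockEquiv hkn (Sum.inl j)) = 0 := by
      intro i j
      rw [Units.val_mul, Matrix.mul_apply, ← (blockEquiv hkn).sum_comp, Fintype.sum_sum_type]
      simp only [unipotent_inv_val_apply, Matrix.fromBlocks_apply₂₁, Matrix.fromBlocks_apply₂₂,
        Matrix.of_apply]
      have h1 : ∑ l, A (i, l) * h.1 (blockEquiv hkn (Sum.inl l)) (blockEquiv hkn (Sum.inl j)) =
          h.1 (blockEquiv hkn (Sum.inr i)) (blockEquiv hkn (Sum.inl j)) := by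
        change (H.toBlocks₂₁ * H.toBlocks₁₁⁻¹ * H.toBlocks₁₁) i j = _
        rw [Matrix.mul_assoc, Matrix.nonsing_inv_mul _ hu.1, Matrix.mul_one]
        rfl
      simp only [Pi.neg_apply, neg_mul, Finset.sum_neg_distrib, h1, Matrix.one_apply, ite_mul,
        one_mul, zero_mul, Finset.sum_ite_eq, Finset.mem_univ, if_true, neg_add_cancel]
    have h2 := flat_mul_congr hkn (unipotent hkn A) (flat_eq_one_of_blocks hkn hz)
    rwa [mul_inv_cancel_left, mul_one] at h2

theorem flat_eq_of_blocks (hkn : k ≤ n) {g g' : GL (Fin (n + 1)) ℤ_[p]}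
    (h : ∀ i j, (g⁻¹ * g').1 (blockEquiv hkn (Sum.inr i)) (blockEquiv hkn (Sum.inl j)) = 0) :
    flat hkn g = flat hkn g' := by
  have h2 := flat_mul_congr hkn g (flat_eq_one_of_blocks hkn h)
  rwa [mul_inv_cancel_left, mul_one, eq_comm] at h2

theorem exists_glCoe_mulVec_single_eq {N : ℕ}
    (b : Module.Basis (Fin N) ℤ_[p] (Fin N → ℤ_[p])) :
    ∃ g : GL (Fin N) ℤ_[p], ∀ j,
      (Matrix.of (glCoe p N g)).mulVec (Pi.single j 1) = coePi p (Fin N) (b j) := by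
  refine ⟨⟨(Pi.basisFun ℤ_[p] (Fin N)).toMatrix b, b.toMatrix (Pi.basisFun ℤ_[p] (Fin N)),
    Module.Basis.toMatrix_mul_toMatrix_flip _ _, Module.Basis.toMatrix_mul_toMatrix_flip _ _⟩,
    fun j => ?_⟩
  rw [Matrix.mulVec_single_one]
  rfl

/-- Every flat is spanned by the first columns of an invertible matrix over `ℤ_p`. -/
theorem flat_surjective (hkn : k ≤ n) :
    Function.Surjective (flat (p := p) hkn) := by
  classical
  intro L
  let ι : (Fin (n + 1) → ℤ_[p]) →ₗ[ℤ_[p]] (Fin (n + 1) → ℚ_[p]) :=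
    (Algebra.linearMap ℤ_[p] ℚ_[p]).compLeft (Fin (n + 1))
  let N : Submodule ℤ_[p] (Fin (n + 1) → ℤ_[p]) := (L.1.restrictScalars ℤ_[p]).comap ι
  -- The Smith normal form of the lattice `L ∩ ℤ_p^{n+1}` provides a basis of `ℤ_p^{n+1}`, some of
  -- whose members, scaled by `a i`, form a basis of the lattice. The scalars are nonzero, so the
  -- members themselves lie in `L`.
  obtain ⟨m, snf⟩ := Submodule.smithNormalForm (Pi.basisFun ℤ_[p] (Fin (n + 1))) N
  obtain ⟨bM, bN, f, a, hsnf⟩ := snf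
  obtain ⟨g, hcol⟩ := exists_glCoe_mulVec_single_eq bM
  have hginj : Function.Injective (Matrix.of (glCoe p (n + 1) g)).mulVecLin :=
    mulVecLin_injective_of_mem_glSet ⟨g, rfl⟩
  have hli : LinearIndependent ℚ_[p] fun i : Fin m => ι (bM (f i)) := by
    have h1 := ((Pi.basisFun ℚ_[p] (Fin (n + 1))).linearIndependent.map' _
      (LinearMap.ker_eq_bot.mpr hginj)).comp f f.injective
    convert! h1 using 1
    funext i
    simp only [Function.comp_apply, Pi.basisFun_apply, Matrix.mulVecLin_apply, hcol]
    rfl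
  have ha : ∀ i, a i ≠ 0 := by
    intro i h0
    have h1 := hsnf i
    rw [h0, zero_smul] at h1
    exact bN.ne_zero i (Subtype.ext h1)
  have hmem : ∀ i, ι (bM (f i)) ∈ L.1 := by
    intro i
    have h1 : ι (a i • bM (f i)) ∈ L.1 := hsnf i ▸ (bN i).2
    rw [map_smul, ← algebraMap_smul ℚ_[p] (a i)] at h1
    exact (L.1.smul_mem_iff (by simpa using ha i)).mp h1
  have hspan : Submodule.span ℚ_[p] (Set.range fun i : Fin m => ι (bM (f i))) = L.1 := by
    refine le_antisymm (Submodule.span_le.mpr ?_) fun v hv => ?_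
    · rintro _ ⟨i, rfl⟩
      exact hmem i
    -- Clearing denominators moves a vector of `L` into the lattice.
    · obtain ⟨t, ht⟩ := IsLocalization.exist_integer_multiples_of_finset (nonZeroDivisors ℤ_[p])
        (Finset.univ.image v)
      have ht' : ∀ i, ∃ x : ℤ_[p], algebraMap ℤ_[p] ℚ_[p] x = t.1 • v i := fun i =>
        ht (v i) (Finset.mem_image_of_mem v (Finset.mem_univ i))
      choose x hx using ht'
      have hxv : ι x = algebraMap ℤ_[p] ℚ_[p] t.1 • v := by
        funext i
        refine (hx i).trans ?_
        rw [Algebra.smul_def]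
        rfl
      have hxN : x ∈ N := by
        change ι x ∈ L.1
        rw [hxv]
        exact L.1.smul_mem _ hv
      have ht0 : algebraMap ℤ_[p] ℚ_[p] t.1 ≠ 0 := by
        simp [nonZeroDivisors.ne_zero t.2]
      rw [← Submodule.smul_mem_iff _ ht0, ← hxv]
      have h1 := congrArg (fun y : N => ι y.1) (bN.sum_repr ⟨x, hxN⟩)
      simp only [Submodule.coe_sum, Submodule.coe_smul, map_sum, map_smul, hsnf] at h1
      rw [← h1]
      refine Submodule.sum_mem _ fun i _ => ?_
      rw [smul_smul, ← algebraMap_smul ℚ_[p]]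
      exact Submodule.smul_mem _ _ (Submodule.subset_span ⟨i, rfl⟩)
  have hm : m = k + 1 := by
    have h1 := finrank_span_eq_card hli
    rw [hspan, L.2, Fintype.card_fin] at h1
    exact h1.symm
  subst hm
  have hinl : Function.Injective fun j : Fin (k + 1) => blockEquiv hkn (Sum.inl j) :=
    (blockEquiv hkn).injective.comp Sum.inl_injective
  -- This permutation moves the selected basis vectors to the first `k + 1` columns.
  let σ : Equiv.Perm (Fin (n + 1)) := Equiv.extendSubtype
    ((Equiv.ofInjective _ hinl).symm.trans (Equiv.ofInjective f f.injective))
  have hσ : ∀ j, σ (blockEquiv hkn (Sum.inl j)) = f j := by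
    intro j
    rw [Equiv.extendSubtype_apply_of_mem _ _ ⟨j, rfl⟩]
    simp
  obtain ⟨g', hcol'⟩ := exists_glCoe_mulVec_single_eq (bM.reindex σ.symm)
  refine ⟨g', Subtype.ext (Eq.symm (Submodule.eq_of_le_of_finrank_eq ?_ ?_))⟩
  · rw [← hspan, Submodule.span_le]
    rintro _ ⟨i, rfl⟩
    rw [SetLike.mem_coe, mem_flat_iff]
    refine ⟨Pi.single (blockEquiv hkn (Sum.inl i)) 1, fun l => Pi.single_eq_of_ne (by simp) _, ?_⟩
    rw [hcol', Module.Basis.reindex_apply, Equiv.symm_symm, hσ]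
    rfl
  · rw [L.2, (flat hkn g').2]

end Flats

/-! ### Zeroes of the section: flats, equivariance and the chart -/

section Zeros

variable {p : ℕ} [hp : Fact p.Prime] {k n ν : ℕ} {d : Fin ν → ℕ}

theorem mem_sectionZeros_iff (f : PolyList p n d) (ℓ : Grass p k n) :
    ℓ ∈ sectionZeros p k n d f ↔ ∀ j, ∀ v ∈ ℓ.1, polyFun p n (f j).1 v = 0 := by
  constructor
  · intro h j v hv
    exact congrFun (congrArg Subtype.val (congrFun h j)) ⟨v, hv⟩
  · intro h
    funext j
    exact Subtype.ext (funext fun v => h j v.1 v.2)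

theorem polyFun_smul (f : PolyList p n d) (j : Fin ν) (a : ℚ_[p]) (v : Fin (n + 1) → ℚ_[p]) :
    polyFun p n (f j).1 (a • v) = a ^ d j * polyFun p n (f j).1 v := by
  rw [polyFun, polyFun, MvPolynomial.aeval_def, MvPolynomial.aeval_def, MvPolynomial.eval₂_eq',
    MvPolynomial.eval₂_eq', Finset.mul_sum]
  refine Finset.sum_congr rfl fun α hα => ?_
  have hdeg : ∑ i, α i = d j := by
    rw [← Finsupp.degree_eq_sum]
    by_contra h
    exact MvPolynomial.mem_support_iff.mp hα
      (MvPolynomial.IsHomogeneous.coeff_eq_zero (f j).2 h)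
  simp only [Pi.smul_apply, smul_eq_mul, mul_pow, Finset.prod_mul_distrib,
    Finset.prod_pow_eq_pow_sum, hdeg]
  ring

theorem flatsOn_eq_sectionZeros (f : PolyList p n d) :
    flatsOn p k n d f = sectionZeros p k n d f := by
  ext ℓ
  rw [mem_sectionZeros_iff]
  constructor
  · intro h j v hv
    -- The zero vector is not a projective point, so it is written as `0 • u` with `u ≠ 0` in `L`.
    -- Homogeneity then covers it, also in degree zero, where the value at the origin is the
    -- constant itself.
    obtain ⟨u, hu, hu0, a, rfl⟩ : ∃ u ∈ ℓ.1, ∃ _ : u ≠ 0, ∃ a : ℚ_[p], v = a • u := by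
      by_cases hv0 : v = 0
      · have hne : ℓ.1 ≠ ⊥ := by
          intro hbot
          have := ℓ.2
          rw [hbot, finrank_bot] at this
          omega
        obtain ⟨u, hu, hu0⟩ := Submodule.exists_mem_ne_zero_of_ne_bot hne
        exact ⟨u, hu, hu0, 0, by rw [hv0, zero_smul]⟩
      · exact ⟨v, hv, hv0, 1, (one_smul _ _).symm⟩
    have hmk : Projectivization.mk ℚ_[p] u hu0 ∈ zeroLocus p n d f := by
      refine h ?_
      simpa [Projectivization.submodule_mk] using hu
    obtain ⟨b, hb⟩ := Projectivization.exists_smul_eq_mk_rep ℚ_[p] u hu0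
    have h1 := hmk j
    rw [← hb, Units.smul_def, polyFun_smul] at h1
    rw [polyFun_smul, (mul_eq_zero.mp h1).resolve_left (pow_ne_zero _ b.ne_zero), mul_zero]
  · intro h x hx j
    refine h j _ (hx ?_)
    rw [Projectivization.submodule_eq]
    exact Submodule.mem_span_singleton_self _

theorem flat_mul_mem_sectionZeros_iff (hkn : k ≤ n) (g h : GL (Fin (n + 1)) ℤ_[p])
    (f : PolyList p n d) :
    flat hkn (g * h) ∈ sectionZeros p k n d f ↔
      flat hkn h ∈ sectionZeros p k n d (substMatrix g.1 f) := by
  rw [mem_sectionZeros_iff, mem_sectionZeros_iff]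
  refine forall_congr' fun j => ?_
  simp only [polyFun_substMatrix, mem_flat_mul_iff]
  constructor
  · intro H w hw
    exact H _ ⟨w, hw, rfl⟩
  · rintro H _ ⟨w, hw, rfl⟩
    exact H w hw

/-- Over the infinite field `ℚ_p`, a polynomial function vanishes only if all its coefficients do.
By homogeneity, the coefficients recorded in `psi` are all that can be nonzero. -/
theorem flat_unipotent_mem_sectionZeros_iff (hkn : k ≤ n)
    (A : Fin (n - k) × Fin (k + 1) → ℤ_[p]) (f : PolyList p n d) :
    flat hkn (unipotent hkn A) ∈ sectionZeros p k n d f ↔ polyMap (psiPoly p k n d f) A = 0 := by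
  have hhom : ∀ j, (chartPoly p k n (f j).1 (coePi p _ A)).IsHomogeneous (d j) := by
    intro j
    have h := MvPolynomial.IsHomogeneous.aeval (f j).2
      (rowForm (graphMatrix ℚ_[p] k n (coePi p _ A))) (isHomogeneous_rowForm _)
    rw [one_mul] at h
    exact h
  rw [flat_unipotent]
  constructor
  · intro h
    funext r
    have h0 : chartPoly p k n (f r.1).1 (coePi p _ A) = 0 := by
      refine MvPolynomial.funext fun y => ?_
      rw [eval_chartPoly p k n hkn d f, map_zero]
      exact congrFun (congrArg Subtype.val (congrFun h r.1)) _
    have h1 := psi_coePi f A r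
    rw [psi, h0, MvPolynomial.coeff_zero] at h1
    exact PadicInt.ext h1.symm
  · intro h
    have h0 : ∀ j, chartPoly p k n (f j).1 (coePi p _ A) = 0 := by
      intro j
      refine MvPolynomial.ext _ _ fun α => ?_
      rw [MvPolynomial.coeff_zero]
      by_cases hα : α ∈ Finset.finsuppAntidiag (Finset.univ : Finset (Fin (k + 1))) (d j)
      · have h1 := psi_coePi f A ⟨j, ⟨α, hα⟩⟩
        have h2 : MvPolynomial.eval A (psiPoly p k n d f ⟨j, ⟨α, hα⟩⟩) = 0 := congrFun h _
        rw [h2, PadicInt.coe_zero] at h1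
        exact h1
      · refine MvPolynomial.IsHomogeneous.coeff_eq_zero (hhom j) fun h => hα ?_
        rw [Finset.mem_finsuppAntidiag]
        refine ⟨?_, by simp⟩
        rw [← h, Finsupp.degree_eq_sum]
    rw [mem_sectionZeros_iff]
    rintro j v ⟨y, rfl⟩
    have h1 := eval_chartPoly p k n hkn d f (coePi p _ A) j y
    rw [h0, map_zero] at h1
    exact h1.symm

end Zeros

/-! ### Counting zeroes modulo `p ^ r` and passing to the limit -/

section Counting

open Filter Topology

/-- Any finite subset of `Z` is eventually mapped injectively, so the limit inferior is at least its
size. This also covers infinite `Z`. -/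
theorem tendsto_encard_image {X : Type*} {Y : ℕ → Type*} (π : ∀ r, X → Y r)
    (hsep : ∀ x y, x ≠ y → ∀ᶠ r in atTop, π r x ≠ π r y) (Z : Set X) :
    Tendsto (fun r => ((π r '' Z).encard : ℝ≥0∞)) atTop (𝓝 (Z.encard : ℝ≥0∞)) := by
  have hle : ∀ r, ((π r '' Z).encard : ℝ≥0∞) ≤ Z.encard := fun r => by
    exact_mod_cast Set.encard_image_le (π r) Z
  refine tendsto_order.mpr ⟨fun b hb => ?_, fun b hb =>
    Eventually.of_forall fun r => (hle r).trans_lt hb⟩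
  obtain ⟨m, hm, hmZ⟩ : ∃ m : ℕ, b < m ∧ (m : ℕ∞) ≤ Z.encard := by
    rcases eq_or_ne Z.encard ⊤ with h | h
    · rw [h] at hb ⊢
      obtain ⟨m, hm⟩ := ENNReal.exists_nat_gt (ne_top_of_lt hb)
      exact ⟨m, hm, le_top⟩
    · obtain ⟨m, hm⟩ := ENat.ne_top_iff_exists.mp h
      rw [← hm] at hb ⊢
      exact ⟨m, by simpa using hb, le_rfl⟩
  obtain ⟨T, hTZ, hT⟩ := Set.exists_subset_encard_eq hmZ
  have hfin : T.Finite := Set.finite_of_encard_eq_coe hT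
  have hinj : ∀ᶠ r in atTop, Set.InjOn (π r) T := by
    have h1 : ∀ x ∈ T, ∀ y ∈ T, ∀ᶠ r in atTop, x ≠ y → π r x ≠ π r y := by
      intro x _ y _
      by_cases h : x = y
      · exact Eventually.of_forall fun r h' => absurd h h'
      · exact (hsep x y h).mono fun r hr _ => hr
    have h2 : ∀ᶠ r in atTop, ∀ x ∈ T, ∀ y ∈ T, x ≠ y → π r x ≠ π r y :=
      (eventually_all_finite hfin).mpr fun x hx => (eventually_all_finite hfin).mpr (h1 x hx)
    exact h2.mono fun r hr x hx y hy hxy => by_contra fun h => hr x hx y hy h hxy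
  filter_upwards [hinj] with r hr
  refine hm.trans_le ?_
  have h3 : (m : ℕ∞) ≤ (π r '' Z).encard := by
    rw [← hT, ← hr.encard_image]
    exact Set.encard_le_encard (Set.image_mono hTZ)
  exact_mod_cast ENat.toENNReal_le.mpr h3

variable {p : ℕ} [hp : Fact p.Prime] {k n ν : ℕ} {d : Fin ν → ℕ}

/-- The class of a flat modulo `p ^ r`. -/
noncomputable def flatClass (hkn : k ≤ n) (r : ℕ) (ℓ : Grass p k n) :
    GL (Fin (n + 1)) ℤ_[p] ⧸ congrSubgroup p k n r :=
  QuotientGroup.mk (flat_surjective hkn ℓ).choose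

theorem flatClass_flat (hkn : k ≤ n) (r : ℕ) (g : GL (Fin (n + 1)) ℤ_[p]) :
    flatClass hkn r (flat hkn g) = QuotientGroup.mk g := by
  rw [flatClass, QuotientGroup.eq, mem_congrSubgroup_iff hkn]
  intro i j
  rw [blocks_eq_zero_of_flat_eq hkn (flat_surjective hkn (flat hkn g)).choose_spec]
  exact dvd_zero _

/-- For distinct flats the lower left block of `g⁻¹ * g'` has a nonzero entry, which is not
divisible by high powers of `p`. -/
theorem eventually_flatClass_ne (hkn : k ≤ n) (ℓ ℓ' : Grass p k n) (h : ℓ ≠ ℓ') :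
    ∀ᶠ r in atTop, flatClass hkn r ℓ ≠ flatClass hkn r ℓ' := by
  obtain ⟨g, rfl⟩ := flat_surjective hkn ℓ
  obtain ⟨g', rfl⟩ := flat_surjective hkn ℓ'
  have h1 : ∃ i j, (g⁻¹ * g').1 (blockEquiv hkn (Sum.inr i)) (blockEquiv hkn (Sum.inl j)) ≠ 0 := by
    by_contra! h2
    exact h (flat_eq_of_blocks hkn h2)
  obtain ⟨i, j, hij⟩ := h1
  obtain ⟨s, hs⟩ := PadicInt.exists_pow_neg_lt p (norm_pos_iff.mpr hij)
  filter_upwards [eventually_ge_atTop s] with r hr heq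
  rw [flatClass_flat, flatClass_flat, QuotientGroup.eq, mem_congrSubgroup_iff hkn] at heq
  have h3 := heq i j
  rw [← Ideal.mem_span_singleton, ← PadicInt.norm_le_pow_iff_mem_span_pow] at h3
  refine absurd (h3.trans ?_) (not_le.mpr hs)
  exact zpow_le_zpow_right₀ (by exact_mod_cast hp.out.one_lt.le) (by simpa using hr)

/-- Translating by a representative of the coset moves the question to the class of the base flat,
whose members are exactly the flats of the chart with `A` divisible by `p ^ r`. -/
theorem mem_flatClass_image_iff (hkn : k ≤ n) {r : ℕ} (hr : 1 ≤ r) (x : Coeffs p n d)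
    (q : GL (Fin (n + 1)) ℤ_[p] ⧸ congrSubgroup p k n r) :
    q ∈ flatClass hkn r '' sectionZeros p k n d (polyOfCoeffs p n d x) ↔
      coeffsSubst q.out.1 x ∈ zeroNear p k n d r := by
  simp only [zeroNear, Set.mem_ofPred_eq, polyOfCoeffs_coeffsSubst,
    ← flat_unipotent_mem_sectionZeros_iff hkn]
  constructor
  · rintro ⟨ℓ, hℓ, hq⟩
    obtain ⟨g, rfl⟩ := flat_surjective hkn ℓ
    rw [flatClass_flat] at hq
    have hmem : q.out⁻¹ * g ∈ congrSubgroup p k n r := by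
      rw [← QuotientGroup.eq, QuotientGroup.out_eq', hq]
    obtain ⟨A, hA, hflat⟩ := exists_flat_eq_flat_unipotent hkn hr hmem
    refine ⟨A, hA, ?_⟩
    rwa [← hflat, ← flat_mul_mem_sectionZeros_iff, mul_inv_cancel_left]
  · rintro ⟨A, hA, hz⟩
    rw [← flat_mul_mem_sectionZeros_iff] at hz
    refine ⟨_, hz, ?_⟩
    rw [flatClass_flat]
    conv_rhs => rw [← QuotientGroup.out_eq' q]
    rw [eq_comm, QuotientGroup.eq, inv_mul_cancel_left]
    exact unipotent_mem_congrSubgroup hkn hA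

theorem encard_eq_sum_indicator {Q : Type*} [Fintype Q] (S : Set Q) :
    (S.encard : ℝ≥0∞) = ∑ q, S.indicator 1 q := by
  classical
  rw [Set.encard_eq_coe_toFinset_card]
  simp [Set.indicator_apply, Finset.sum_boole, Set.toFinset_card, Fintype.card_subtype]

noncomputable instance (r : ℕ) :
    Fintype (GL (Fin (n + 1)) ℤ_[p] ⧸ congrSubgroup p k n r) :=
  Fintype.ofFinite _

theorem encard_flatClass_image (hkn : k ≤ n) {r : ℕ} (hr : 1 ≤ r) (x : Coeffs p n d) :
    ((flatClass hkn r '' sectionZeros p k n d (polyOfCoeffs p n d x)).encard : ℝ≥0∞) =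
      ∑ q : GL (Fin (n + 1)) ℤ_[p] ⧸ congrSubgroup p k n r,
        (zeroNear p k n d r).indicator 1 (coeffsSubst q.out.1 x) := by
  classical
  rw [encard_eq_sum_indicator]
  refine Finset.sum_congr rfl fun q _ => ?_
  simp only [Set.indicator_apply, mem_flatClass_image_iff hkn hr, Pi.one_apply]

theorem measurable_indicator_coeffsSubst (r : ℕ) (g : GL (Fin (n + 1)) ℤ_[p]) :
    Measurable fun x : Coeffs p n d =>
      (zeroNear p k n d r).indicator (1 : Coeffs p n d → ℝ≥0∞) (coeffsSubst g.1 x) :=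
  (measurable_one.indicator (isClosed_zeroNear r).measurableSet).comp
    (measurePreserving_coeffsSubst g).measurable

theorem measurable_encard_flatClass_image (hkn : k ≤ n) {r : ℕ} (hr : 1 ≤ r) :
    Measurable fun x : Coeffs p n d =>
      ((flatClass hkn r '' sectionZeros p k n d (polyOfCoeffs p n d x)).encard : ℝ≥0∞) := by
  simp only [encard_flatClass_image hkn hr]
  exact Finset.measurable_sum _ fun q _ => measurable_indicator_coeffsSubst r q.out

/-- By invariance of the law under substitutions, every coset contributes the same probability, and
there are as many terms as the index. -/
theorem lintegral_encard_flatClass_image (hkn : k ≤ n) {r : ℕ} (hr : 1 ≤ r) :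
    ∫⁻ x : Coeffs p n d, ((flatClass hkn r ''
        sectionZeros p k n d (polyOfCoeffs p n d x)).encard : ℝ≥0∞) ∂(uniformPi p _) =
      volGL p (n + 1) / (volGL p (k + 1) * volGL p (n - k)) *
        (((p : ℝ≥0∞) ^ r) ^ Fintype.card (Fin (n - k) × Fin (k + 1)) *
          uniformPi p _ (zeroNear p k n d r)) := by
  simp only [encard_flatClass_image hkn hr]
  rw [lintegral_finsetSum _ fun q _ => measurable_indicator_coeffsSubst r q.out]
  have h1 : ∀ g : GL (Fin (n + 1)) ℤ_[p], ∫⁻ x : Coeffs p n d,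
      (zeroNear p k n d r).indicator (1 : Coeffs p n d → ℝ≥0∞) (coeffsSubst g.1 x)
        ∂(uniformPi p _) = uniformPi p _ (zeroNear p k n d r) := by
    intro g
    rw [(measurePreserving_coeffsSubst g).lintegral_comp
      (measurable_one.indicator (isClosed_zeroNear r).measurableSet),
      lintegral_indicator_one (isClosed_zeroNear r).measurableSet]
  simp only [h1, Finset.sum_const, Finset.card_univ, nsmul_eq_mul]
  rw [← Nat.card_eq_fintype_card, ← Subgroup.index_eq_card, index_congrSubgroup_eq hkn hr]
  ring

theorem measurable_encard_sectionZeros (hkn : k ≤ n) :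
    Measurable fun x : Coeffs p n d =>
      ((sectionZeros p k n d (polyOfCoeffs p n d x)).encard : ℝ≥0∞) := by
  refine ENNReal.measurable_of_tendsto
    -- The shift to `r + 1` ensures that the modulus is at least `p`, as the description of the
    -- classes requires.
    (f := fun r x => ((flatClass hkn (r + 1) ''
      sectionZeros p k n d (polyOfCoeffs p n d x)).encard : ℝ≥0∞))
    (fun r => measurable_encard_flatClass_image hkn (Nat.le_add_left 1 r)) ?_
  rw [tendsto_pi_nhds]
  intro x
  exact (tendsto_encard_image _ (eventually_flatClass_ne hkn) _).comp (tendsto_add_atTop_nat 1)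

/-- The expected number of zeroes of the section, for uniformly distributed coefficients. -/
theorem lintegral_encard_sectionZeros (hkn : k ≤ n)
    (e : Fin (n - k) × Fin (k + 1) ≃ CoeffIndex k d) :
    ∫⁻ x : Coeffs p n d, ((sectionZeros p k n d (polyOfCoeffs p n d x)).encard : ℝ≥0∞)
        ∂(uniformPi p _) =
      volGL p (n + 1) / (volGL p (k + 1) * volGL p (n - k)) *
        ∫⁻ x : Coeffs p n d, ‖(linearPart (chartMap e x)).det‖ₑ ∂(uniformPi p _) := by
  set N : ℕ → Coeffs p n d → ℝ≥0∞ := fun r x => ((flatClass hkn (r + 1) ''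
      sectionZeros p k n d (polyOfCoeffs p n d x)).encard : ℝ≥0∞) with hN
  have hNlim : ∀ x, Tendsto (fun r => N r x) atTop
      (𝓝 ((sectionZeros p k n d (polyOfCoeffs p n d x)).encard : ℝ≥0∞)) := fun x =>
    (tendsto_encard_image _ (eventually_flatClass_ne hkn) _).comp (tendsto_add_atTop_nat 1)
  have hNle : ∀ r x, N r x ≤ ((sectionZeros p k n d (polyOfCoeffs p n d x)).encard : ℝ≥0∞) :=
    fun r x => ENat.toENNReal_le.mpr (Set.encard_image_le _ _)
  have hlim : Tendsto (fun r => ∫⁻ x, N r x ∂(uniformPi p _)) atTop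
      (𝓝 (volGL p (n + 1) / (volGL p (k + 1) * volGL p (n - k)) *
        ∫⁻ x : Coeffs p n d, ‖(linearPart (chartMap e x)).det‖ₑ ∂(uniformPi p _))) := by
    simp only [hN, lintegral_encard_flatClass_image hkn (Nat.le_add_left 1 _)]
    refine ENNReal.Tendsto.const_mul
      ((tendsto_uniformPi_zeroNear hkn e).comp (tendsto_add_atTop_nat 1)) (Or.inr ?_)
    exact ENNReal.div_ne_top volGL_ne_top (mul_ne_zero volGL_ne_zero volGL_ne_zero)
  -- The counts need not be monotone in a form ready for use, nor dominated by an integrable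
  -- function known in advance. Fatou's lemma gives `≤`, and `N r x ≤ N x` gives `≥`.
  refine le_antisymm ?_ (le_of_tendsto' hlim fun r => lintegral_mono (hNle r))
  calc _ = ∫⁻ x, liminf (fun r => N r x) atTop ∂(uniformPi p _) :=
        lintegral_congr fun x => (hNlim x).liminf_eq.symm
    _ ≤ liminf (fun r => ∫⁻ x, N r x ∂(uniformPi p _)) atTop :=
        lintegral_liminf_le fun r =>
          measurable_encard_flatClass_image hkn (Nat.le_add_left 1 r)
    _ = _ := hlim.liminf_eq

theorem measurable_grassMap (hkn : k ≤ n) : Measurable (grassMap p k n hkn) := by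
  refine Continuous.measurable ?_
  have h : Continuous (colSpan p k n) := continuous_coinduced_rng
  refine h.comp (Continuous.subtype_mk ?_ _)
  exact Continuous.matrix_mul continuous_subtype_val continuous_const

/-- The total measure of the Grassmannian. -/
theorem grassMeasure_univ (hkn : k ≤ n) : grassMeasure p k n hkn Set.univ =
    volGL p (n + 1) / (volGL p (k + 1) * volGL p (n - k)) := by
  rw [grassMeasure, Measure.smul_apply, Measure.map_apply (measurable_grassMap hkn) .univ,
    Set.preimage_univ, (MeasurableEmbedding.subtype_coe measurableSet_glSet).comap_apply,
    Set.image_univ, Subtype.range_coe, smul_eq_mul, ENNReal.div_eq_inv_mul,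
    mul_comm (volGL p (n - k))]
  rfl

end Counting

end PadicFlats

theorem theorem2p6 (p : ℕ) [Fact p.Prime] (k n ν : ℕ) (hkn : k ≤ n) (d : Fin ν → ℕ)
    (hd : ∑ j, Nat.choose (k + d j) (d j) = (k + 1) * (n - k))
    {Ω : Type*} [MeasurableSpace Ω] (P : Measure Ω) [IsProbabilityMeasure P]
    (ξ : (Σ j : Fin ν, PadicFlats.Exps n (d j)) → Ω → ℤ_[p])
    (hξ : ∀ i, Measurable (ξ i))
    (hunif : ∀ i, P.map (ξ i) = PadicFlats.uniformPadicInt p)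
    (hindep : iIndepFun ξ P)
    (f : Ω → PadicFlats.PolyList p n d)
    (hf : ∀ ω, f ω = PadicFlats.polyOfCoeffs p n d (fun i => ξ i ω))
    (e : Fin (n - k) × Fin (k + 1) ≃ PadicFlats.CoeffIndex k d) :
    -- the numbers of flats and of zeroes, and the determinant, are random variables
    Measurable (fun ω => ((PadicFlats.flatsOn p k n d (f ω)).encard : ℝ≥0∞)) ∧
    Measurable (fun ω => ((PadicFlats.sectionZeros p k n d (f ω)).encard : ℝ≥0∞)) ∧
    Measurable (fun ω => ‖((PadicFlats.jacobian p k n d (f ω) 0).submatrix e id).det‖ₑ) ∧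
    -- the expectation formula
    ∫⁻ ω, ((PadicFlats.flatsOn p k n d (f ω)).encard : ℝ≥0∞) ∂P =
      ∫⁻ ω, ((PadicFlats.sectionZeros p k n d (f ω)).encard : ℝ≥0∞) ∂P ∧
    ∫⁻ ω, ((PadicFlats.sectionZeros p k n d (f ω)).encard : ℝ≥0∞) ∂P =
      PadicFlats.grassMeasure p k n hkn Set.univ *
        ∫⁻ ω, ‖((PadicFlats.jacobian p k n d (f ω) 0).submatrix e id).det‖ₑ ∂P ∧
    -- the total measure of the Grassmannian
    PadicFlats.grassMeasure p k n hkn Set.univ =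
      PadicFlats.volGL p (n + 1) / (PadicFlats.volGL p (k + 1) * PadicFlats.volGL p (n - k)) := by
  have hX : Measurable fun ω i => ξ i ω := measurable_pi_lambda _ hξ
  -- Independence and uniform marginals make the coefficient vector Haar distributed on `ℤ_p^ι`,
  -- with `ι` its index set, so everything reduces to integrals over the space of coefficients.
  have hlaw : P.map (fun ω i => ξ i ω) =
      PadicFlats.uniformPi p (Σ j : Fin ν, PadicFlats.Exps n (d j)) := by
    rw [(iIndepFun_iff_map_fun_eq_pi_map fun i => (hξ i).aemeasurable).mp hindep]
    simp only [hunif]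
  have hdet : Measurable fun x : PadicFlats.Coeffs p n d =>
      ‖(PadicFlats.linearPart (PadicFlats.chartMap e x)).det‖ₑ :=
    (PadicFlats.continuous_det_linearPart e).measurable.enorm
  have hcount := PadicFlats.measurable_encard_sectionZeros (p := p) (d := d) hkn
  simp only [PadicFlats.flatsOn_eq_sectionZeros, PadicFlats.enorm_det_jacobian, hf]
  refine ⟨hcount.comp hX, hcount.comp hX, hdet.comp hX, trivial, ?_,
    PadicFlats.grassMeasure_univ hkn⟩
  rw [PadicFlats.grassMeasure_univ]
  have h := PadicFlats.lintegral_encard_sectionZeros (p := p) (d := d) hkn e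
  rw [← hlaw, lintegral_map hcount hX, lintegral_map hdet hX] at h
  exact h
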